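/- Let $n\ge 2$, let $D\subset\mathbb R^n$ be a bounded domain and let $s\colon D\to[1,\infty)$ be measurable and log-Hölder continuous, i.e. for some $c>0$, $|s(x)-s(y)|\le c/\log(e+1/|x-y|)$ for all $x\ne y$ in $D$. Write $s^-:=\operatorname{ess\,inf}_D s$, $s^+:=\operatorname{ess\,sup}_D s$ and assume $1\le s^-\le s^+<\frac n{n-1}$. Suppose that $D$ is an $s(\cdot)$-John domain with John centre $x_0\in D$: there are constants $0<\alpha_0\le\beta_0<\infty$ such that each $x\in D$ can be joined to $x_0$ by a rectifiable curve $\gamma_x\colon[0,\ell]\to D$, parametrized by arc length, with $\gamma_x(0)=x$, $\gamma_x(\ell)=x_0$, $\ell\le\beta_0$ and $t^{s(x)}\le\frac{\beta_0}{\alpha_0}\operatorname{dist}(\gamma_x(t),\partial D)$ for all $t\in[0,\ell]$. Put $\alpha(x):=n-s(x)(n-1)$ and $B:=B(x_0,\operatorname{dist}(x_0,\partial D))$. For $p\colon D\to[1,\infty)$ measurable and bounded, $L^{p(\cdot)}(D)$ is the set of measurable $f$ on $D$ with $\int_D|f|^{p(x)}dx<\infty$, with the norm $\|f\|_{L^{p(\cdot)}(D)}=\inf\{\lambda>0:\int_D|f(x)/\lambda|^{p(x)}dx\le1\}$,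 and $L^1_{p(\cdot)}(D)$ is the set of $u\in W^{1,1}_{\mathrm{loc}}(D)$ with $|\nabla u|\in L^{p(\cdot)}(D)$. For $A\subset D$ let $$\mathcal H^{s(\cdot)(n-1)}_\infty(A):=\inf\Big\{\sum_{i=1}^\infty r_i^{s(x_i)(n-1)}:\ A\subset\bigcup_{i=1}^\infty B(x_i,r_i),\ x_i\in D,\ r_i\ge0\Big\},$$ and for $f\colon D\to\mathbb R$ let $\int_D|f|\,d\mathcal H^{s(\cdot)(n-1)}_\infty:=\int_0^\infty\mathcal H^{s(\cdot)(n-1)}_\infty(\{x\in D:|f(x)|>t\})\,dt$ (Choquet integral). Then there exist constants $a,b>0$ such that $$\int_D\exp\Big(a\,|u-u_B|^{\frac{n}{s^+(n-1)}}\Big)\,d\mathcal H^{s(\cdot)(n-1)}_\infty\le b$$ for all $u\in L^1_{n/\alpha(\cdot)}(D)$ with $\|\nabla u\|_{L^{n/\alpha(\cdot)}(D)}\le1$. Here $u_B$ is the average of $u$ over $B$, and the pointwise values of $u$ in the integrand are those of its precise representative, $u(x)=\lim_{r\to0^+}\frac1{|B(x,r)|}\int_{B(x,r)}u\,dy$ where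 this limit exists, and $u(x)=0$ elsewhere. -/

import Mathlib

open MeasureTheory Set Filter Topology
open scoped ENNReal ContDiff

noncomputable section

/-- `g` is log-Hölder continuous on `U`. -/
def IsLogHolderOn {E : Type*} [MetricSpace E] (g : E → ℝ) (U : Set E) : Prop :=
  ∃ c : ℝ, 0 < c ∧ ∀ x ∈ U, ∀ y ∈ U, x ≠ y →
    |g x - g y| ≤ c / Real.log (Real.exp 1 + 1 / dist x y)

/-- The essential supremum of `g` on `U`. -/
def essSupOn {E : Type*} [MeasureSpace E] (g : E → ℝ) (U : Set E) : ℝ :=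
  essSup g (volume.restrict U)

/-- The essential infimum of `g` on `U`. -/
def essInfOn {E : Type*} [MeasureSpace E] (g : E → ℝ) (U : Set E) : ℝ :=
  essInf g (volume.restrict U)

/-- `p` is a log-Hölder continuous variable exponent on `U`: a measurable, essentially bounded,
log-Hölder continuous function with values in `[1, ∞)`. Values of `p` outside `U` are irrelevant. -/
structure IsLogHolderExponent {E : Type*} [MetricSpace E] [MeasureSpace E]
    (p : E → ℝ) (U : Set E) : Prop where
  measurable : Measurable (fun x : U => p x)
  one_le : ∀ x ∈ U, 1 ≤ p x
  essBounded : ∃ C : ℝ, ∀ᵐ x ∂(volume.restrict U), p x ≤ C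
  logHolder : IsLogHolderOn p U

/-- The modular `∫_U |f(x)| ^ p(x) dx`. -/
def varModular {E : Type*} [MeasureSpace E] (U : Set E) (p : E → ℝ) (f : E → ℝ) : ℝ≥0∞ :=
  ∫⁻ x in U, ENNReal.ofReal (|f x| ^ p x)

/-- Membership in the variable exponent Lebesgue space `L^{p(·)}(U)`. -/
def MemVarLp {E : Type*} [MeasureSpace E] (U : Set E) (p : E → ℝ) (f : E → ℝ) : Prop :=
  AEStronglyMeasurable f (volume.restrict U) ∧ varModular U p f < ⊤

/-- The Luxemburg--Nakano norm on `L^{p(·)}(U)`, with value `∞` if no `l` is admissible. -/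
def luxemburgNorm {E : Type*} [MeasureSpace E] (U : Set E) (p : E → ℝ) (f : E → ℝ) : ℝ≥0∞ :=
  ⨅ (l : ℝ) (_ : 0 < l) (_ : varModular U p (fun x => f x / l) ≤ 1), ENNReal.ofReal l

/-- `u` lies in `W^{1,1}_loc(U)` and its distributional gradient is represented by `g`. -/
structure HasWeakGradientOn {n : ℕ} (U : Set (EuclideanSpace ℝ (Fin n)))
    (u : EuclideanSpace ℝ (Fin n) → ℝ)
    (g : EuclideanSpace ℝ (Fin n) → EuclideanSpace ℝ (Fin n)) : Prop where
  locallyIntegrable : LocallyIntegrableOn u U volume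
  locallyIntegrable_grad : LocallyIntegrableOn g U volume
  integral_eq : ∀ φ : EuclideanSpace ℝ (Fin n) → ℝ, ContDiff ℝ ∞ φ → HasCompactSupport φ →
    tsupport φ ⊆ U → ∀ v : EuclideanSpace ℝ (Fin n),
      ∫ x in U, u x * fderiv ℝ φ x v = - ∫ x in U, inner ℝ (g x) v * φ x

/-- `u` belongs to the variable exponent Sobolev space `L^1_{p(·)}(U)`, with distributional
gradient `g`. The gradient is determined by `u` up to a null set of `U`. -/
structure MemVarSobolev {n : ℕ} (U : Set (EuclideanSpace ℝ (Fin n)))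
    (p : EuclideanSpace ℝ (Fin n) → ℝ) (u : EuclideanSpace ℝ (Fin n) → ℝ)
    (g : EuclideanSpace ℝ (Fin n) → EuclideanSpace ℝ (Fin n)) : Prop where
  hasWeakGradient : HasWeakGradientOn U u g
  memVarLp : MemVarLp U p (fun x => ‖g x‖)

open Classical in
/-- The precise representative of a locally integrable function: the limit of the averages over
balls shrinking to `x` where it exists, and `0` elsewhere. -/
def preciseRep {E : Type*} [MetricSpace E] [MeasureSpace E] (u : E → ℝ) (x : E) : ℝ :=
  if h : ∃ l : ℝ, Tendsto (fun r : ℝ => ⨍ y in Metric.ball x r, u y) (𝓝[>] 0) (𝓝 l)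
  then h.choose else 0

/-- The variable dimensional Hausdorff content `H_∞^{β(·)}(A)` for a dimension function `β` that is
defined on `U` (its values outside `U` are not used): the infimum of `∑ r_i ^ β(x_i)` over all
countable covers of `A` by open balls `B(x_i, r_i)` with centres in the domain `U` of `β`.
Empty balls, `r_i = 0`, are allowed, so that finite covers are included. -/
def varHausdorffContent {E : Type*} [MetricSpace E] (U : Set E) (β : E → ℝ) (A : Set E) : ℝ≥0∞ :=
  ⨅ (x : ℕ → E) (r : ℕ → ℝ) (_ : ∀ i, x i ∈ U) (_ : ∀ i, 0 ≤ r i)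
    (_ : A ⊆ ⋃ i, Metric.ball (x i) (r i)), ∑' i, ENNReal.ofReal (r i ^ β (x i))

/-- The Choquet integral `∫_U |f| dH = ∫_0^∞ H({x ∈ U : |f(x)| > t}) dt` of `f` over `U` with
respect to a set function `H`. -/
def choquetIntegral {E : Type*} (H : Set E → ℝ≥0∞) (U : Set E) (f : E → ℝ) : ℝ≥0∞ :=
  ∫⁻ t in Ioi (0 : ℝ), H {x ∈ U | t < |f x|}

/-- `D` is an `s(·)`-John domain with John centre `x₀` and John constants `a ≤ b`. -/
structure IsVarJohnDomainWith {n : ℕ} (D : Set (EuclideanSpace ℝ (Fin n)))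
    (s : EuclideanSpace ℝ (Fin n) → ℝ) (x₀ : EuclideanSpace ℝ (Fin n)) (a b : ℝ) : Prop where
  isOpen : IsOpen D
  isConnected : IsConnected D
  isBounded : Bornology.IsBounded D
  one_le : ∀ x ∈ D, 1 ≤ s x
  center_mem : x₀ ∈ D
  const_pos : 0 < a
  const_le : a ≤ b
  exists_curve : ∀ x ∈ D, ∃ (L : ℝ) (γ : ℝ → EuclideanSpace ℝ (Fin n)),
    0 ≤ L ∧ L ≤ b ∧ HasUnitSpeedOn γ (Icc 0 L) ∧ MapsTo γ (Icc 0 L) D ∧ γ 0 = x ∧ γ L = x₀ ∧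
      ∀ t ∈ Icc 0 L, t ^ s x ≤ b / a * Metric.infDist (γ t) (frontier D)

/-- `D` is an `s(·)`-John domain with John centre `x₀`. -/
def IsVarJohnDomain {n : ℕ} (D : Set (EuclideanSpace ℝ (Fin n)))
    (s : EuclideanSpace ℝ (Fin n) → ℝ) (x₀ : EuclideanSpace ℝ (Fin n)) : Prop :=
  ∃ a b : ℝ, IsVarJohnDomainWith D s x₀ a b

end

/-!
The John curve from a point `x` of `D` to `x₀` is covered by a chain of balls on which
the Poincaré inequality controls the oscillation of `u`. Summing along the chain and grouping the
balls by their scale bounds `|u(x) - u_B|` by the potential `∑ k, ρ_k ^ (-β) ∫_{B(x, ρ_k)} |∇u|`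
with `ρ_k = r₀ 2 ^ (-k)` and `β = β(x) = s(x)(n - 1)`.

Let `ν` be the measure with density `|∇u| ^ (n / (n - β(·)))` and let `β⁺ = s⁺(n - 1) < n`.
Log-Hölder continuity makes `ρ ^ β(y)` comparable to `ρ ^ β(x)` for `y` in `B(x, ρ)`. Hence Young's
inequality with a parameter `t ≥ 1` bounds the contribution of the annulus
`A_k = B(x, ρ_k) \ B(x, ρ_{k + 1})` by `t ν(A_k) + C t ^ (1 - n / β⁺)`. With `t = M ^ (β⁺ / n)` the
first `M` contributions add up to at most a constant times `M ^ (β⁺ / n)`. If moreover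
`ν(B(x, ρ_{M + k})) ≤ 2 ^ (-k)` for all `k`, the remaining contributions add up to at most a
constant. By Vitali's covering lemma the points `x` for which this fails have content at most a
constant times `2 ^ (-M)`.

So the content of `{|u - u_B| > C M ^ (β⁺ / n)}` decays exponentially in `M`, which means that
`|u - u_B| ^ (n / β⁺)` is exponentially integrable.
-/

noncomputable section

open Metric

section SmoothPoincare

variable {E : Type*} [NormedAddCommGroup E] [NormedSpace ℝ E]

theorem hasDerivAt_segment (y z : E) (t : ℝ) :
    HasDerivAt (fun t : ℝ => (1 - t) • z + t • y) (y - z) t := by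
  have hline : (fun t : ℝ => (1 - t) • z + t • y) = AffineMap.lineMap z y :=
    funext fun t => (AffineMap.lineMap_apply_module z y t).symm
  exact hline ▸ AffineMap.hasDerivAt_lineMap

theorem enorm_sub_le_lintegral_fderiv {w : E → ℝ} (hw : ContDiff ℝ 1 w) (y z : E) :
    ‖w y - w z‖ₑ ≤ ‖y - z‖ₑ * ∫⁻ t in Icc (0 : ℝ) 1, ‖fderiv ℝ w ((1 - t) • z + t • y)‖ₑ := by
  have hderiv (t : ℝ) : deriv (fun t : ℝ => w ((1 - t) • z + t • y)) t
      = fderiv ℝ w ((1 - t) • z + t • y) (y - z) :=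
    ((hw.differentiable one_ne_zero _).hasFDerivAt.comp_hasDerivAt t
      (hasDerivAt_segment y z t)).deriv
  have hsegment : ContDiff ℝ 1 (fun t : ℝ => w ((1 - t) • z + t • y)) := hw.comp (by fun_prop)
  calc ‖w y - w z‖ₑ
      ≤ ∫⁻ t in Icc (0 : ℝ) 1, ‖deriv (fun t : ℝ => w ((1 - t) • z + t • y)) t‖ₑ := by
        simpa using
          enorm_sub_le_lintegral_deriv_of_contDiffOn_Icc hsegment.contDiffOn zero_le_one
    _ ≤ ∫⁻ t in Icc (0 : ℝ) 1, ‖y - z‖ₑ * ‖fderiv ℝ w ((1 - t) • z + t • y)‖ₑ :=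
        lintegral_mono fun t => by
          rw [hderiv, mul_comm]
          exact ContinuousLinearMap.le_opENorm _ _
    _ = _ := lintegral_const_mul' _ _ enorm_ne_top

variable [MeasurableSpace E] [BorelSpace E] [FiniteDimensional ℝ E]
  (μ : Measure E) [μ.IsAddHaarMeasure]

theorem lintegral_comp_add_smul {F : E → ℝ≥0∞} (hF : Measurable F) (a : E) {t : ℝ} (ht : t ≠ 0) :
    ∫⁻ y, F (a + t • y) ∂μ = ENNReal.ofReal |(t ^ Module.finrank ℝ E)⁻¹| * ∫⁻ y, F y ∂μ := by
  have hmap : ∫⁻ y, F (a + t • y) ∂μ = ∫⁻ z, F (a + z) ∂(Measure.map (fun y => t • y) μ) := by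
    rw [lintegral_map (by fun_prop) (by fun_prop)]
  rw [hmap, Measure.map_addHaar_smul μ ht, lintegral_smul_measure, lintegral_add_left_eq_self F a,
    smul_eq_mul]

theorem setLIntegral_comp_segment_le {F : E → ℝ≥0∞} (hF : Measurable F) {B : Set E}
    (hB : MeasurableSet B) (hconv : Convex ℝ B) {a : E} (ha : a ∈ B) {t : ℝ}
    (ht : 1 / 2 ≤ t) (ht1 : t ≤ 1) :
    ∫⁻ y in B, F ((1 - t) • a + t • y) ∂μ
      ≤ 2 ^ Module.finrank ℝ E * ∫⁻ y in B, F y ∂μ := by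
  have ht0 : 0 < t := by linarith
  have hJacobian : ENNReal.ofReal |(t ^ Module.finrank ℝ E)⁻¹| ≤ 2 ^ Module.finrank ℝ E := by
    have hinv : t⁻¹ ≤ 2 := by
      rw [inv_le_comm₀ ht0 two_pos]
      linarith
    rw [abs_of_pos (by positivity), ← inv_pow, ENNReal.ofReal_pow (by positivity)]
    gcongr
    exact ENNReal.ofReal_le_of_le_toReal (by simpa using hinv)
  rw [← lintegral_indicator hB, ← lintegral_indicator hB]
  calc ∫⁻ y, B.indicator (fun y => F ((1 - t) • a + t • y)) y ∂μ
      ≤ ∫⁻ y, B.indicator F ((1 - t) • a + t • y) ∂μ := by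
        refine lintegral_mono fun y => indicator_apply_le' (fun hy => ?_) fun _ => zero_le
        rw [indicator_of_mem (hconv ha hy (by linarith) ht0.le (by ring))]
    _ = ENNReal.ofReal |(t ^ Module.finrank ℝ E)⁻¹| * ∫⁻ y, B.indicator F y ∂μ :=
        lintegral_comp_add_smul μ (hF.indicator hB) _ ht0.ne'
    _ ≤ 2 ^ Module.finrank ℝ E * ∫⁻ y, B.indicator F y ∂μ := by gcongr

/-- A point of the segment is at least half way from one of the endpoints; the average over the
other endpoint is then comparable with the average of `F`. -/
theorem setLIntegral_prod_comp_segment_le {F : E → ℝ≥0∞} (hF : Measurable F) {B : Set E}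
    (hB : MeasurableSet B) (hconv : Convex ℝ B) {t : ℝ} (ht : t ∈ Icc (0 : ℝ) 1) :
    ∫⁻ p in B ×ˢ B, F ((1 - t) • p.2 + t • p.1) ∂(μ.prod μ)
      ≤ 2 ^ Module.finrank ℝ E * μ B * ∫⁻ y in B, F y ∂μ := by
  have hF' : Measurable (fun p : E × E => F ((1 - t) • p.2 + t • p.1)) := by fun_prop
  have hconst : ∫⁻ _ in B, 2 ^ Module.finrank ℝ E * ∫⁻ y in B, F y ∂μ ∂μ
      = 2 ^ Module.finrank ℝ E * μ B * ∫⁻ y in B, F y ∂μ := by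
    rw [setLIntegral_const]
    ring
  rw [← Measure.prod_restrict, ← hconst]
  rcases le_total (1 / 2) t with h | h
  · rw [lintegral_prod_symm _ hF'.aemeasurable]
    exact setLIntegral_mono measurable_const fun z hz =>
      setLIntegral_comp_segment_le μ hF hB hconv hz h ht.2
  · rw [lintegral_prod _ hF'.aemeasurable]
    refine setLIntegral_mono measurable_const fun y hy => ?_
    simpa only [sub_sub_cancel, add_comm] using
      setLIntegral_comp_segment_le μ hF hB hconv hy (t := 1 - t) (by linarith) (by linarith [ht.1])

theorem lintegral_ball_sub_le_of_contDiff {w : E → ℝ} (hw : ContDiff ℝ 1 w) (x : E) (r : ℝ) :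
    ∫⁻ p in ball x r ×ˢ ball x r, ‖w p.1 - w p.2‖ₑ ∂(μ.prod μ)
      ≤ 2 ^ (Module.finrank ℝ E + 1) * ENNReal.ofReal r * μ (ball x r) *
        ∫⁻ y in ball x r, ‖fderiv ℝ w y‖ₑ ∂μ := by
  have hcont : Continuous (fderiv ℝ w) := hw.continuous_fderiv one_ne_zero
  have hdiam {p : E × E} (hp : p ∈ ball x r ×ˢ ball x r) :
      ‖p.1 - p.2‖ₑ ≤ ENNReal.ofReal (2 * r) := by
    rw [← edist_eq_enorm_sub, edist_dist]
    refine ENNReal.ofReal_le_ofReal ?_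
    linarith [dist_triangle p.1 x p.2, mem_ball.1 hp.1, mem_ball'.1 hp.2]
  calc ∫⁻ p in ball x r ×ˢ ball x r, ‖w p.1 - w p.2‖ₑ ∂(μ.prod μ)
      ≤ ∫⁻ p in ball x r ×ˢ ball x r, ENNReal.ofReal (2 * r) *
          (∫⁻ t in Icc (0 : ℝ) 1, ‖fderiv ℝ w ((1 - t) • p.2 + t • p.1)‖ₑ) ∂(μ.prod μ) :=
        setLIntegral_mono' (measurableSet_ball.prod measurableSet_ball) fun p hp =>
          (enorm_sub_le_lintegral_fderiv hw p.1 p.2).trans (mul_le_mul_left (hdiam hp) _)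
    _ = ENNReal.ofReal (2 * r) * ∫⁻ t in Icc (0 : ℝ) 1, ∫⁻ p in ball x r ×ˢ ball x r,
          ‖fderiv ℝ w ((1 - t) • p.2 + t • p.1)‖ₑ ∂(μ.prod μ) := by
        rw [lintegral_const_mul' _ _ ENNReal.ofReal_ne_top, lintegral_lintegral_swap]
        exact (Continuous.enorm (by fun_prop)).measurable.aemeasurable
    _ ≤ ENNReal.ofReal (2 * r) * ∫⁻ _ in Icc (0 : ℝ) 1, 2 ^ Module.finrank ℝ E * μ (ball x r) *
          ∫⁻ y in ball x r, ‖fderiv ℝ w y‖ₑ ∂μ := by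
        gcongr 1
        exact setLIntegral_mono measurable_const fun t ht =>
          setLIntegral_prod_comp_segment_le μ hcont.enorm.measurable measurableSet_ball
            (convex_ball x r) ht
    _ = _ := by
        rw [setLIntegral_const, Real.volume_Icc, sub_zero, ENNReal.ofReal_one, mul_one,
          ENNReal.ofReal_mul two_pos.le, ENNReal.ofReal_ofNat]
        ring

end SmoothPoincare

section Mollification

open scoped Convolution

variable {E : Type*} [NormedAddCommGroup E] [NormedSpace ℝ E]

theorem fderiv_comp_const_sub {f : E → ℝ} (hf : Differentiable ℝ f) (a b : E) :
    fderiv ℝ (fun y => f (a - y)) b = -fderiv ℝ f (a - b) := by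
  ext e
  have hcomp := (hf (a - b)).hasFDerivAt.comp b ((hasFDerivAt_id b).const_sub a)
  rw [show fderiv ℝ (fun y => f (a - y)) b = _ from hcomp.fderiv]
  simp

variable [MeasurableSpace E] [BorelSpace E] [FiniteDimensional ℝ E] {μ : Measure E}
  [μ.IsAddHaarMeasure]

theorem fderiv_convolution_lsmul_apply {f v : E → ℝ} (hf : ContDiff ℝ 1 f)
    (hfc : HasCompactSupport f) (hv : LocallyIntegrable v μ) (a e : E) :
    fderiv ℝ (f ⋆[ContinuousLinearMap.lsmul ℝ ℝ, μ] v) a e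
      = ∫ b, fderiv ℝ f (a - b) e * v b ∂μ := by
  have hexists := (hfc.fderiv ℝ).convolutionExists_left
    (ContinuousLinearMap.precompL E (ContinuousLinearMap.lsmul ℝ ℝ))
    (hf.continuous_fderiv one_ne_zero) hv a
  rw [(hfc.hasFDerivAt_convolution_left (ContinuousLinearMap.lsmul ℝ ℝ) hf hv a).fderiv,
    convolution_def, ContinuousLinearMap.integral_apply hexists,
    ← integral_sub_left_eq_self _ μ a]
  simp only [ContinuousLinearMap.precompL_apply, ContinuousLinearMap.lsmul_apply, smul_eq_mul,
    sub_sub_cancel]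

theorem tsupport_normed_const_sub_subset (φ : ContDiffBump (0 : E)) (a : E) :
    tsupport (fun b => φ.normed μ (a - b)) ⊆ closedBall a φ.rOut := by
  refine closure_minimal (fun b hb => ?_) isClosed_closedBall
  have hab : a - b ∈ tsupport (φ.normed μ) := subset_closure hb
  rwa [φ.tsupport_normed_eq, mem_closedBall_zero_iff, ← dist_eq_norm, dist_comm] at hab

theorem lintegral_enorm_normed_sub (φ : ContDiffBump (0 : E)) (b : E) :
    ∫⁻ a, ‖φ.normed μ (a - b)‖ₑ ∂μ = 1 := by
  rw [lintegral_sub_right_eq_self (fun a => ‖φ.normed μ a‖ₑ) b]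
  simp only [Real.enorm_of_nonneg (φ.nonneg_normed _)]
  rw [← ofReal_integral_eq_lintegral_ofReal φ.integrable_normed
    (Eventually.of_forall φ.nonneg_normed), φ.integral_normed, ENNReal.ofReal_one]

theorem exists_contDiffBump_seq_tendsto_ae {v : E → ℝ} (hv : LocallyIntegrable v μ) {ε : ℝ}
    (hε : 0 < ε) :
    ∃ φ : ℕ → ContDiffBump (0 : E), (∀ k, (φ k).rOut ≤ ε) ∧ ∀ᵐ y ∂μ,
      Tendsto (fun k => ((φ k).normed μ ⋆[ContinuousLinearMap.lsmul ℝ ℝ, μ] v) y) atTop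
        (𝓝 (v y)) := by
  have hpos (k : ℕ) : 0 < ε * (1 / (k + 1)) := by positivity
  let φ (k : ℕ) : ContDiffBump (0 : E) :=
    ⟨ε * (1 / (k + 1)) / 2, ε * (1 / (k + 1)), half_pos (hpos k), half_lt_self (hpos k)⟩
  have hrOut : Tendsto (fun k => (φ k).rOut) atTop (𝓝 0) := by
    simpa only [φ, mul_zero] using
      (tendsto_one_div_add_atTop_nhds_zero_nat (𝕜 := ℝ)).const_mul ε
  refine ⟨φ, fun k => ?_, ContDiffBump.ae_convolution_tendsto_right_of_locallyIntegrable (K := 2)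
    hrOut (Eventually.of_forall fun k => (mul_div_cancel₀ _ two_ne_zero).ge) hv⟩
  exact mul_le_of_le_one_right hε.le ((div_le_one (by positivity)).2 (by simp))

end Mollification

section WeakPoincare

open scoped Convolution

variable {n : ℕ} {D U K : Set (EuclideanSpace ℝ (Fin n))} {u : EuclideanSpace ℝ (Fin n) → ℝ}
  {g : EuclideanSpace ℝ (Fin n) → EuclideanSpace ℝ (Fin n)}

theorem HasWeakGradientOn.mono (h : HasWeakGradientOn D u g) (hU : U ⊆ D) :
    HasWeakGradientOn U u g where
  locallyIntegrable := h.locallyIntegrable.mono_set hU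
  locallyIntegrable_grad := h.locallyIntegrable_grad.mono_set hU
  integral_eq φ hφ hφc hφU v := by
    have hgrad (x) (hx : x ∉ tsupport φ) : u x * fderiv ℝ φ x v = 0 := by
      have hfx : fderiv ℝ φ x = 0 := by
        by_contra hne
        exact hx (support_fderiv_subset ℝ hne)
      rw [hfx, zero_apply, mul_zero]
    have hval (x) (hx : x ∉ tsupport φ) : inner ℝ (g x) v * φ x = 0 := by
      rw [image_eq_zero_of_notMem_tsupport hx, mul_zero]
    have heq := h.integral_eq φ hφ hφc (hφU.trans hU) v
    rwa [setIntegral_eq_integral_of_forall_compl_eq_zero fun x hx => hgrad x fun hxφ =>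
        hx (hU (hφU hxφ)),
      setIntegral_eq_integral_of_forall_compl_eq_zero fun x hx => hval x fun hxφ =>
        hx (hU (hφU hxφ)),
      ← setIntegral_eq_integral_of_forall_compl_eq_zero fun x hx => hgrad x fun hxφ =>
        hx (hφU hxφ),
      ← setIntegral_eq_integral_of_forall_compl_eq_zero fun x hx => hval x fun hxφ =>
        hx (hφU hxφ)] at heq

theorem HasWeakGradientOn.locallyIntegrable_indicator (h : HasWeakGradientOn U u g)
    (hK : IsCompact K) (hKU : K ⊆ U) : LocallyIntegrable (K.indicator u) volume :=
  (((h.locallyIntegrable.mono_set hKU).integrableOn_isCompact hK).integrable_indicator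
    hK.measurableSet).locallyIntegrable

theorem HasWeakGradientOn.fderiv_convolution_indicator_apply (h : HasWeakGradientOn U u g)
    (hK : IsCompact K) (hKU : K ⊆ U) (φ : ContDiffBump (0 : EuclideanSpace ℝ (Fin n)))
    {a : EuclideanSpace ℝ (Fin n)} (ha : closedBall a φ.rOut ⊆ K)
    (e : EuclideanSpace ℝ (Fin n)) :
    fderiv ℝ (φ.normed volume ⋆[ContinuousLinearMap.lsmul ℝ ℝ, volume] (K.indicator u)) a e
      = ∫ b in U, inner ℝ (g b) e * φ.normed volume (a - b) := by
  have hφ : ContDiff ℝ 1 (φ.normed (volume : Measure (EuclideanSpace ℝ (Fin n)))) :=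
    φ.contDiff_normed
  have hψ : ContDiff ℝ ∞ fun b => φ.normed volume (a - b) := φ.contDiff_normed.comp (by fun_prop)
  have hsupport := tsupport_normed_const_sub_subset (μ := volume) φ a
  have hψc : HasCompactSupport fun b => φ.normed volume (a - b) :=
    (isCompact_closedBall a φ.rOut).of_isClosed_subset (isClosed_tsupport _) hsupport
  have hfderiv_zero (b) (hb : b ∉ K) : fderiv ℝ (fun y => φ.normed volume (a - y)) b = 0 := by
    by_contra hne
    exact hb (ha (hsupport (support_fderiv_subset ℝ hne)))
  have hweak := h.integral_eq _ hψ hψc (hsupport.trans (ha.trans hKU)) e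
  rw [setIntegral_eq_integral_of_forall_compl_eq_zero fun b hb => by
    rw [hfderiv_zero b fun hbK => hb (hKU hbK), zero_apply, mul_zero]] at hweak
  rw [fderiv_convolution_lsmul_apply hφ φ.hasCompactSupport_normed
    (h.locallyIntegrable_indicator hK hKU), ← neg_inj, ← hweak, ← integral_neg]
  refine integral_congr_ae (Eventually.of_forall fun b => ?_)
  dsimp only
  by_cases hb : b ∈ K
  · rw [indicator_of_mem hb, fderiv_comp_const_sub (hφ.differentiable one_ne_zero),
      neg_apply]
    ring
  · rw [indicator_of_notMem hb, hfderiv_zero b hb, zero_apply, mul_zero, mul_zero,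
      neg_zero]

theorem HasWeakGradientOn.enorm_fderiv_convolution_le (h : HasWeakGradientOn U u g)
    (hK : IsCompact K) (hKU : K ⊆ U) (φ : ContDiffBump (0 : EuclideanSpace ℝ (Fin n)))
    {a : EuclideanSpace ℝ (Fin n)} (ha : closedBall a φ.rOut ⊆ K) :
    ‖fderiv ℝ (φ.normed volume ⋆[ContinuousLinearMap.lsmul ℝ ℝ, volume] (K.indicator u)) a‖ₑ
      ≤ ∫⁻ b in U, ‖g b‖ₑ * ‖φ.normed volume (a - b)‖ₑ := by
  refine ContinuousLinearMap.opENorm_le_bound _ fun e => ?_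
  rw [h.fderiv_convolution_indicator_apply hK hKU φ ha e,
    ← lintegral_mul_const' _ _ enorm_ne_top]
  refine (enorm_integral_le_lintegral_enorm _).trans (lintegral_mono fun b => ?_)
  have hinner : ‖(inner ℝ (g b) e : ℝ)‖ₑ ≤ ‖g b‖ₑ * ‖e‖ₑ := by
    simp only [enorm_eq_nnnorm]
    exact_mod_cast nnnorm_inner_le_nnnorm (𝕜 := ℝ) (g b) e
  rw [enorm_mul, mul_right_comm]
  gcongr

theorem HasWeakGradientOn.lintegral_fderiv_convolution_le (h : HasWeakGradientOn U u g)
    (hK : IsCompact K) (hKU : K ⊆ U) (φ : ContDiffBump (0 : EuclideanSpace ℝ (Fin n)))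
    {S : Set (EuclideanSpace ℝ (Fin n))} (hS : MeasurableSet S)
    (hSK : ∀ a ∈ S, closedBall a φ.rOut ⊆ K) :
    ∫⁻ a in S, ‖fderiv ℝ (φ.normed volume ⋆[ContinuousLinearMap.lsmul ℝ ℝ, volume]
        (K.indicator u)) a‖ₑ ≤ ∫⁻ b in U, ‖g b‖ₑ := by
  have hφ : Continuous (φ.normed (volume : Measure (EuclideanSpace ℝ (Fin n)))) :=
    φ.continuous_normed
  have hmeas : AEMeasurable (fun p : EuclideanSpace ℝ (Fin n) × EuclideanSpace ℝ (Fin n) =>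
      ‖g p.2‖ₑ * ‖φ.normed volume (p.1 - p.2)‖ₑ) ((volume.restrict S).prod (volume.restrict U)) :=
    h.locallyIntegrable_grad.aestronglyMeasurable.enorm.comp_snd.mul
      (Continuous.enorm (by fun_prop)).measurable.aemeasurable
  calc _ ≤ ∫⁻ a in S, ∫⁻ b in U, ‖g b‖ₑ * ‖φ.normed volume (a - b)‖ₑ :=
        setLIntegral_mono' hS fun a ha => h.enorm_fderiv_convolution_le hK hKU φ (hSK a ha)
    _ = ∫⁻ b in U, ∫⁻ a in S, ‖g b‖ₑ * ‖φ.normed volume (a - b)‖ₑ :=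
        lintegral_lintegral_swap hmeas
    _ ≤ ∫⁻ b in U, ‖g b‖ₑ := by
        refine lintegral_mono fun b => ?_
        rw [lintegral_const_mul' _ _ enorm_ne_top]
        refine mul_le_of_le_one_right' ((setLIntegral_le_lintegral _ _).trans_eq ?_)
        exact lintegral_enorm_normed_sub φ b

theorem setLIntegral_prod_enorm_sub_le_of_tendsto {X : Type*} [MeasurableSpace X]
    {μ : Measure X} {B : Set X} (hB : MeasurableSet B) {v : X → ℝ} {w : ℕ → X → ℝ}
    (hw : ∀ k, Measurable (w k))
    (hlim : ∀ᵐ x ∂μ, x ∈ B → Tendsto (fun k => w k x) atTop (𝓝 (v x))) {C : ℝ≥0∞}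
    (hC : ∀ k, ∫⁻ p in B ×ˢ B, ‖w k p.1 - w k p.2‖ₑ ∂(μ.prod μ) ≤ C) :
    ∫⁻ p in B ×ˢ B, ‖v p.1 - v p.2‖ₑ ∂(μ.prod μ) ≤ C := by
  have hliminf : ∀ᵐ p ∂(μ.prod μ).restrict (B ×ˢ B),
      ‖v p.1 - v p.2‖ₑ ≤ liminf (fun k => ‖w k p.1 - w k p.2‖ₑ) atTop := by
    rw [ae_restrict_iff' (hB.prod hB)]
    filter_upwards [Measure.quasiMeasurePreserving_fst.ae hlim,
      Measure.quasiMeasurePreserving_snd.ae hlim] with p hfst hsnd hp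
    exact ((hfst hp.1).sub (hsnd hp.2)).enorm.liminf_eq.ge
  calc ∫⁻ p in B ×ˢ B, ‖v p.1 - v p.2‖ₑ ∂(μ.prod μ)
      ≤ ∫⁻ p in B ×ˢ B, liminf (fun k => ‖w k p.1 - w k p.2‖ₑ) atTop ∂(μ.prod μ) :=
        lintegral_mono_ae hliminf
    _ ≤ liminf (fun k => ∫⁻ p in B ×ˢ B, ‖w k p.1 - w k p.2‖ₑ ∂(μ.prod μ)) atTop :=
        lintegral_liminf_le fun k =>
          (((hw k).comp measurable_fst).sub ((hw k).comp measurable_snd)).enorm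
    _ ≤ C := liminf_le_of_le (by isBoundedDefault) fun b hb =>
        let ⟨k, hk⟩ := hb.exists
        hk.trans (hC k)

theorem HasWeakGradientOn.lintegral_ball_sub_le_of_lt {x : EuclideanSpace ℝ (Fin n)} {ρ r : ℝ}
    (h : HasWeakGradientOn (ball x r) u g) (hρr : ρ < r) :
    ∫⁻ p in ball x ρ ×ˢ ball x ρ, ‖u p.1 - u p.2‖ₑ ∂(volume.prod volume)
      ≤ 2 ^ (n + 1) * ENNReal.ofReal r * volume (ball x r) * ∫⁻ y in ball x r, ‖g y‖ₑ := by
  obtain ⟨ρ', hρ, hρ'⟩ := exists_between hρr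
  have hK : IsCompact (closedBall x ρ') := isCompact_closedBall x ρ'
  have hKU : closedBall x ρ' ⊆ ball x r := closedBall_subset_ball hρ'
  have hv := h.locallyIntegrable_indicator hK hKU
  obtain ⟨φ, hφ, hlim⟩ := exists_contDiffBump_seq_tendsto_ae hv (sub_pos.2 hρ)
  have hsmooth (k : ℕ) : ContDiff ℝ 1 ((φ k).normed volume
      ⋆[ContinuousLinearMap.lsmul ℝ ℝ, volume] ((closedBall x ρ').indicator u)) :=
    (φ k).hasCompactSupport_normed.contDiff_convolution_left _ (φ k).contDiff_normed hv
  refine setLIntegral_prod_enorm_sub_le_of_tendsto measurableSet_ball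
    (fun k => (hsmooth k).continuous.measurable) ?_ fun k => ?_
  · filter_upwards [hlim] with y hy hyB
    rwa [indicator_of_mem (ball_subset_closedBall (ball_subset_ball hρ.le hyB))] at hy
  · refine (lintegral_ball_sub_le_of_contDiff volume (hsmooth k) x ρ).trans ?_
    rw [finrank_euclideanSpace_fin]
    refine mul_le_mul' (by gcongr) ?_
    refine h.lintegral_fderiv_convolution_le hK hKU (φ k) measurableSet_ball fun a ha => ?_
    refine closedBall_subset_closedBall' ?_
    linarith [mem_ball.1 ha, hφ k]

theorem HasWeakGradientOn.lintegral_ball_sub_le (h : HasWeakGradientOn D u g)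
    {x : EuclideanSpace ℝ (Fin n)} {r : ℝ} (hr : ball x r ⊆ D) :
    ∫⁻ p in ball x r ×ˢ ball x r, ‖u p.1 - u p.2‖ₑ ∂(volume.prod volume)
      ≤ 2 ^ (n + 1) * ENNReal.ofReal r * volume (ball x r) * ∫⁻ y in ball x r, ‖g y‖ₑ := by
  obtain ⟨ρ, hρmono, hρlt, hρlim⟩ := exists_seq_strictMono_tendsto r
  have hmono : Monotone fun k => ball x (ρ k) ×ˢ ball x (ρ k) := fun i j hij =>
    prod_mono (ball_subset_ball (hρmono.monotone hij)) (ball_subset_ball (hρmono.monotone hij))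
  have hexhaust : ball x r ×ˢ ball x r = ⋃ k, ball x (ρ k) ×ˢ ball x (ρ k) := by
    refine Subset.antisymm (fun p hp => mem_iUnion.2 ?_) (iUnion_subset fun k =>
      prod_mono (ball_subset_ball (hρlt k).le) (ball_subset_ball (hρlt k).le))
    exact ((hρlim.eventually_const_lt (mem_ball.1 hp.1)).and
      (hρlim.eventually_const_lt (mem_ball.1 hp.2))).exists
  rw [hexhaust, setLIntegral_iUnion_of_directed _ hmono.directed_le]
  exact iSup_le fun k => (h.mono hr).lintegral_ball_sub_le_of_lt (hρlt k)

end WeakPoincare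

section MeasureLemmas

variable {X : Type*} [MeasurableSpace X] {μ : Measure X}

theorem edist_average_le_lintegral [IsFiniteMeasure μ] [NeZero μ] {f : X → ℝ}
    (hf : Integrable f μ) (c : ℝ) :
    edist c (⨍ z, f z ∂μ) ≤ (μ univ)⁻¹ * ∫⁻ z, ‖c - f z‖ₑ ∂μ := by
  have hsub : c - ⨍ z, f z ∂μ = ⨍ z, (c - f z) ∂μ := by
    conv_lhs => rw [← average_const μ c]
    exact (integral_sub (integrable_const c) hf.to_average).symm
  rw [edist_eq_enorm_sub, hsub, average]
  refine (enorm_integral_le_lintegral_enorm _).trans_eq ?_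
  rw [lintegral_smul_measure, smul_eq_mul]

theorem integrable_of_lintegral_lintegral_enorm_sub_ne_top [IsFiniteMeasure μ] [NeZero μ]
    {f : X → ℝ} (hf : AEStronglyMeasurable f μ)
    (hfin : ∫⁻ y, ∫⁻ z, ‖f y - f z‖ₑ ∂μ ∂μ ≠ ⊤) : Integrable f μ := by
  have hmeas : AEMeasurable (fun p : X × X => ‖f p.1 - f p.2‖ₑ) (μ.prod μ) :=
    (hf.comp_fst.sub hf.comp_snd).enorm
  obtain ⟨y, hy⟩ := (ae_lt_top' hmeas.lintegral_prod_right' hfin).exists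
  have hsub : Integrable (fun z => f y - f z) μ := ⟨aestronglyMeasurable_const.sub hf, hy⟩
  simpa only [Pi.sub_def, sub_sub_cancel] using (integrable_const (f y)).sub hsub

theorem sum_setLIntegral_le_of_card_le {ι : Type*} {U : Set X} {F : X → ℝ≥0∞}
    (hF : AEMeasurable F (μ.restrict U)) (I : Finset ι) {B : ι → Set X}
    (hB : ∀ i, MeasurableSet (B i)) (hBU : ∀ i ∈ I, B i ⊆ U) (N : ℕ)
    (hN : ∀ z, ∀ J ⊆ I, (∀ i ∈ J, z ∈ B i) → J.card ≤ N) :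
    ∑ i ∈ I, ∫⁻ z in B i, F z ∂μ ≤ N * ∫⁻ z in U, F z ∂μ := by
  classical
  have hoverlap (z : X) : ∑ i ∈ I, (B i).indicator F z ≤ N * F z :=
    calc ∑ i ∈ I, (B i).indicator F z = ((I.filter fun i => z ∈ B i).card : ℝ≥0∞) * F z := by
          simp only [indicator_apply, ← Finset.sum_filter, Finset.sum_const, nsmul_eq_mul]
      _ ≤ N * F z := by
          gcongr
          exact hN z _ (Finset.filter_subset _ _) fun i hi => (Finset.mem_filter.1 hi).2
  calc ∑ i ∈ I, ∫⁻ z in B i, F z ∂μ = ∑ i ∈ I, ∫⁻ z in U, (B i).indicator F z ∂μ :=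
        Finset.sum_congr rfl fun i hi => by
          rw [setLIntegral_indicator (hB i), inter_eq_left.2 (hBU i hi)]
    _ = ∫⁻ z in U, ∑ i ∈ I, (B i).indicator F z ∂μ :=
        (lintegral_finsetSum' _ fun i _ => hF.indicator (hB i)).symm
    _ ≤ ∫⁻ z in U, N * F z ∂μ := lintegral_mono hoverlap
    _ = N * ∫⁻ z in U, F z ∂μ := lintegral_const_mul' _ _ (ENNReal.natCast_ne_top N)

end MeasureLemmas

section StepChains

/-- A chain of `m` steps of length at most `ρ` that joins `p` to `q` inside `S`; the values `c i`
for `i > m` are irrelevant. Chains of balls centred at its points carry estimates from `p`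
to `q`. -/
structure IsStepChain {X : Type*} [PseudoMetricSpace X] (S : Set X) (ρ : ℝ) (p q : X) (m : ℕ)
    (c : ℕ → X) : Prop where
  apply_zero : c 0 = p
  apply_length : c m = q
  mem : ∀ i ≤ m, c i ∈ S
  dist_le : ∀ i < m, dist (c i) (c (i + 1)) ≤ ρ

variable {X : Type*} [PseudoMetricSpace X] {S : Set X} {ρ : ℝ} {p q : X} {m : ℕ} {c : ℕ → X}

theorem IsStepChain.exists_shortcut (h : IsStepChain S ρ p q m c) {i k : ℕ} (hik : i + 2 ≤ k)
    (hkm : k ≤ m) (hdist : dist (c i) (c k) ≤ ρ) :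
    ∃ m' < m, ∃ c', IsStepChain S ρ p q m' c' := by
  obtain ⟨d, rfl⟩ := Nat.exists_eq_add_of_le hik
  refine ⟨m - (d + 1), by omega, fun l => if l ≤ i then c l else c (l + (d + 1)), ?_, ?_, ?_, ?_⟩
  · simpa using h.apply_zero
  · rw [if_neg (by omega), Nat.sub_add_cancel (by omega), h.apply_length]
  · intro l hl
    split_ifs
    · exact h.mem l (by omega)
    · exact h.mem _ (by omega)
  · intro l hl
    rcases lt_trichotomy l i with hli | rfl | hli
    · rw [if_pos hli.le, if_pos (Nat.succ_le_of_lt hli)]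
      exact h.dist_le l (by omega)
    · rw [if_pos le_rfl, if_neg (by omega), show l + 1 + (d + 1) = l + 2 + d by ring]
      exact hdist
    · rw [if_neg (by omega), if_neg (by omega), add_right_comm]
      exact h.dist_le _ (by omega)

theorem IsStepChain.exists_without_shortcut (h : IsStepChain S ρ p q m c) :
    ∃ m' c', IsStepChain S ρ p q m' c' ∧
      ∀ i k, i + 2 ≤ k → k ≤ m' → ρ < dist (c' i) (c' k) := by
  classical
  have hexists : ∃ m c, IsStepChain S ρ p q m c := ⟨m, c, h⟩
  obtain ⟨c', hc'⟩ := Nat.find_spec hexists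
  refine ⟨Nat.find hexists, c', hc', fun i k hik hk => ?_⟩
  by_contra! hdist
  obtain ⟨m', hm', hshort⟩ := hc'.exists_shortcut hik hk hdist
  exact Nat.find_min hexists hm' hshort

theorem exists_isStepChain_of_lipschitzOnWith {γ : ℝ → X} {a b : ℝ} (hab : a ≤ b) (hρ : 0 < ρ)
    (hγ : LipschitzOnWith 1 γ (Icc a b)) :
    ∃ m c, IsStepChain (γ '' Icc a b) ρ (γ a) (γ b) m c := by
  have hmem (i : ℕ) : min (a + i * ρ) b ∈ Icc a b :=
    ⟨le_min (le_add_of_nonneg_right (by positivity)) hab, min_le_right _ _⟩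
  refine ⟨⌈(b - a) / ρ⌉₊, fun i => γ (min (a + i * ρ) b), ?_, ?_, ?_, ?_⟩
  · simp [hab]
  · have hlast : b ≤ a + ⌈(b - a) / ρ⌉₊ * ρ := by
      linarith [(div_le_iff₀ hρ).1 (Nat.le_ceil ((b - a) / ρ))]
    exact congrArg γ (min_eq_right hlast)
  · exact fun i _ => mem_image_of_mem γ (hmem i)
  · intro i _
    calc dist (γ (min (a + i * ρ) b)) (γ (min (a + (i + 1 : ℕ) * ρ) b))
        ≤ dist (min (a + i * ρ) b) (min (a + (i + 1 : ℕ) * ρ) b) := by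
          simpa using hγ.dist_le_mul _ (hmem i) _ (hmem (i + 1))
      _ ≤ max |a + i * ρ - (a + (i + 1 : ℕ) * ρ)| |b - b| := abs_min_sub_min_le_max _ _ _ _
      _ = ρ := by
          push_cast
          rw [sub_self, abs_zero, show a + i * ρ - (a + (i + 1) * ρ) = -ρ by ring, abs_neg,
            abs_of_pos hρ, max_eq_left hρ.le]

end StepChains

section BoundedOverlap

variable {E : Type*} [NormedAddCommGroup E] [NormedSpace ℝ E] [FiniteDimensional ℝ E] {ρ : ℝ}

theorem card_le_of_separated_of_dist_lt (hρ : 0 < ρ) (z : E) {c : ℕ → E} (J : Finset ℕ)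
    (hz : ∀ i ∈ J, dist z (c i) < 2 * ρ)
    (hsep : ∀ i ∈ J, ∀ k ∈ J, i ≠ k → ρ < dist (c i) (c k)) :
    J.card ≤ 5 ^ Module.finrank ℝ E := by
  classical
  let F (i : ℕ) : E := ρ⁻¹ • (c i - z)
  have hdist (i k : ℕ) : ‖F i - F k‖ = dist (c i) (c k) / ρ := by
    rw [← smul_sub, norm_smul, sub_sub_sub_cancel_right, Real.norm_of_nonneg (by positivity),
      dist_eq_norm, inv_mul_eq_div]
  have hsep' : ∀ i ∈ J, ∀ k ∈ J, i ≠ k → 1 < ‖F i - F k‖ := fun i hi k hk hik => by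
    rw [hdist, one_lt_div hρ]
    exact hsep i hi k hk hik
  have hinj : InjOn F J := fun i hi k hk hik => by
    by_contra hne
    have hlt := hsep' i hi k hk hne
    rw [hik, sub_self, norm_zero] at hlt
    exact zero_lt_one.not_gt hlt
  rw [← Finset.card_image_of_injOn hinj]
  refine Besicovitch.card_le_of_separated _ ?_ ?_
  · simp only [Finset.forall_mem_image]
    intro i hi
    rw [norm_smul, Real.norm_of_nonneg (by positivity), inv_mul_eq_div, div_le_iff₀ hρ,
      ← dist_eq_norm, dist_comm]
    exact (hz i hi).le
  · simp only [Finset.forall_mem_image]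
    exact fun i hi k hk hik => (hsep' i hi k hk (ne_of_apply_ne F hik)).le

/-- Two indices of equal parity differ by at least two, so the points with even and those with odd
index are separated. -/
theorem card_le_of_chain_without_shortcut (hρ : 0 < ρ) (z : E) {c : ℕ → E} {m : ℕ}
    (hsep : ∀ i k, i + 2 ≤ k → k ≤ m → ρ < dist (c i) (c k)) (J : Finset ℕ)
    (hJ : J ⊆ Finset.range m) (hz : ∀ i ∈ J, dist z (c i) < 2 * ρ) :
    J.card ≤ 2 * 5 ^ Module.finrank ℝ E := by
  have hparity (P : ℕ → Prop) [DecidablePred P]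
      (hP : ∀ i k, P i → P k → i ≠ k → i % 2 = k % 2) :
      (J.filter P).card ≤ 5 ^ Module.finrank ℝ E := by
    refine card_le_of_separated_of_dist_lt hρ z _ (fun i hi => hz i (Finset.mem_filter.1 hi).1) ?_
    intro i hi k hk hik
    obtain ⟨hiJ, hiP⟩ := Finset.mem_filter.1 hi
    obtain ⟨hkJ, hkP⟩ := Finset.mem_filter.1 hk
    have hmod := hP i k hiP hkP hik
    rcases lt_or_gt_of_ne hik with hlt | hlt
    · exact hsep i k (by omega) (Finset.mem_range.1 (hJ hkJ)).le
    · rw [dist_comm]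
      exact hsep k i (by omega) (Finset.mem_range.1 (hJ hiJ)).le
  have heven := hparity (fun i => i % 2 = 0) (fun i k hi hk _ => by rw [hi, hk])
  have hodd := hparity (fun i => ¬ i % 2 = 0) (fun i k hi hk _ => by omega)
  have hcard := Finset.card_filter_add_card_filter_not (s := J) (fun i => i % 2 = 0)
  omega

end BoundedOverlap

section Averages

variable {n : ℕ} {D : Set (EuclideanSpace ℝ (Fin n))} {u : EuclideanSpace ℝ (Fin n) → ℝ}
  {g : EuclideanSpace ℝ (Fin n) → EuclideanSpace ℝ (Fin n)}

/-- The constant of the Poincaré inequality for averages over comparable balls of `ℝⁿ`. -/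
def poincareConst (n : ℕ) : ℝ≥0∞ :=
  2 ^ (n + 1) * (volume (ball (0 : EuclideanSpace ℝ (Fin n)) 1))⁻¹

theorem poincareConst_ne_top (n : ℕ) : poincareConst n ≠ ⊤ :=
  ENNReal.mul_ne_top (by finiteness)
    (ENNReal.inv_ne_top.2 (measure_ball_pos volume _ one_pos).ne')

theorem HasWeakGradientOn.aestronglyMeasurable_ball (h : HasWeakGradientOn D u g)
    {x : EuclideanSpace ℝ (Fin n)} {r : ℝ} (hr : ball x r ⊆ D) :
    AEStronglyMeasurable u (volume.restrict (ball x r)) :=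
  (h.locallyIntegrable.mono_set hr).aestronglyMeasurable

theorem HasWeakGradientOn.lintegral_lintegral_ball_sub_le (h : HasWeakGradientOn D u g)
    {x : EuclideanSpace ℝ (Fin n)} {r : ℝ} (hr : ball x r ⊆ D) :
    ∫⁻ y in ball x r, ∫⁻ z in ball x r, ‖u y - u z‖ₑ
      ≤ 2 ^ (n + 1) * ENNReal.ofReal r * volume (ball x r) * ∫⁻ y in ball x r, ‖g y‖ₑ := by
  have hu := h.aestronglyMeasurable_ball hr
  refine le_trans (le_of_eq ?_) (h.lintegral_ball_sub_le hr)
  rw [← Measure.prod_restrict, lintegral_prod]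
  exact (hu.comp_fst.sub hu.comp_snd).enorm

theorem neZero_volume_restrict_ball (x : EuclideanSpace ℝ (Fin n)) {r : ℝ} (hr : 0 < r) :
    NeZero ((volume : Measure (EuclideanSpace ℝ (Fin n))).restrict (ball x r)) :=
  ⟨Measure.restrict_eq_zero.not.2 (measure_ball_pos volume x hr).ne'⟩

theorem HasWeakGradientOn.integrableOn_ball (h : HasWeakGradientOn D u g)
    {x : EuclideanSpace ℝ (Fin n)} {r : ℝ} (hr : ball x r ⊆ D) (hr0 : 0 < r)
    (hg : ∫⁻ y in ball x r, ‖g y‖ₑ ≠ ⊤) : IntegrableOn u (ball x r) := by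
  have hvolume : volume (ball x r) ≠ ⊤ := measure_ball_lt_top.ne
  have := isFiniteMeasure_restrict.2 hvolume
  have := neZero_volume_restrict_ball x hr0
  refine integrable_of_lintegral_lintegral_enorm_sub_ne_top (h.aestronglyMeasurable_ball hr)
    (ne_top_of_le_ne_top ?_ (h.lintegral_lintegral_ball_sub_le hr))
  finiteness

theorem HasWeakGradientOn.edist_average_le_inv_volume (h : HasWeakGradientOn D u g)
    {p q : EuclideanSpace ℝ (Fin n)} {r r' : ℝ} (hr0 : 0 < r) (hr : ball p r ⊆ D) (hr'0 : 0 < r')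
    (hsub : ball q r' ⊆ ball p r) :
    edist (⨍ y in ball p r, u y) (⨍ y in ball q r', u y)
      ≤ 2 ^ (n + 1) * ENNReal.ofReal r * (volume (ball q r'))⁻¹ * ∫⁻ y in ball p r, ‖g y‖ₑ := by
  have hV0 : volume (ball p r) ≠ 0 := (measure_ball_pos volume p hr0).ne'
  have hVtop : volume (ball p r) ≠ ⊤ := measure_ball_lt_top.ne
  have := isFiniteMeasure_restrict.2 hVtop
  have := isFiniteMeasure_restrict.2 (measure_ball_lt_top (μ := volume) (x := q) (r := r')).ne
  have := neZero_volume_restrict_ball p hr0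
  have := neZero_volume_restrict_ball q hr'0
  by_cases hg : ∫⁻ y in ball p r, ‖g y‖ₑ = ⊤
  · have hV' : (volume (ball q r'))⁻¹ ≠ 0 := ENNReal.inv_ne_zero.2 measure_ball_lt_top.ne
    rw [hg, ENNReal.mul_top (by simp [hr0, hV'])]
    exact le_top
  have hu := h.integrableOn_ball hr hr0 hg
  calc edist (⨍ y in ball p r, u y) (⨍ y in ball q r', u y)
      ≤ (volume (ball q r'))⁻¹ * ∫⁻ y in ball q r', ‖(⨍ z in ball p r, u z) - u y‖ₑ := by
        simpa only [Measure.restrict_apply_univ] using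
          edist_average_le_lintegral (hu.mono_set hsub) (⨍ y in ball p r, u y)
    _ ≤ (volume (ball q r'))⁻¹ *
          ∫⁻ y in ball p r, (volume (ball p r))⁻¹ * ∫⁻ z in ball p r, ‖u y - u z‖ₑ := by
        refine mul_le_mul_right ((lintegral_mono_set hsub).trans (lintegral_mono fun y => ?_)) _
        rw [← edist_eq_enorm_sub, edist_comm]
        simpa only [Measure.restrict_apply_univ] using edist_average_le_lintegral hu (u y)
    _ = (volume (ball q r'))⁻¹ *
          ((volume (ball p r))⁻¹ * ∫⁻ y in ball p r, ∫⁻ z in ball p r, ‖u y - u z‖ₑ) := by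
        rw [lintegral_const_mul' _ _ (ENNReal.inv_ne_top.2 hV0)]
    _ ≤ (volume (ball q r'))⁻¹ * ((volume (ball p r))⁻¹ * (2 ^ (n + 1) * ENNReal.ofReal r *
          volume (ball p r) * ∫⁻ y in ball p r, ‖g y‖ₑ)) := by
        gcongr
        exact h.lintegral_lintegral_ball_sub_le hr
    _ = ((volume (ball p r))⁻¹ * volume (ball p r)) * (2 ^ (n + 1) * ENNReal.ofReal r *
          (volume (ball q r'))⁻¹ * ∫⁻ y in ball p r, ‖g y‖ₑ) := by ring
    _ = _ := by rw [ENNReal.inv_mul_cancel hV0 hVtop, one_mul]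

theorem ofReal_mul_inv_volume_ball_le {r r' A : ℝ} (hr : 0 < r) (hr' : 0 < r') (hA : r ≤ A * r')
    (q : EuclideanSpace ℝ (Fin n)) :
    ENNReal.ofReal r * (volume (ball q r'))⁻¹
      ≤ ENNReal.ofReal (A ^ n * r ^ (1 - (n : ℝ))) *
        (volume (ball (0 : EuclideanSpace ℝ (Fin n)) 1))⁻¹ := by
  have hscale : r * (r' ^ n)⁻¹ ≤ A ^ n * r ^ (1 - (n : ℝ)) := by
    rw [Real.rpow_sub hr, Real.rpow_one, Real.rpow_natCast, ← div_eq_mul_inv, mul_div_assoc',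
      div_le_div_iff₀ (by positivity) (by positivity), mul_right_comm, ← mul_pow, mul_comm r]
    gcongr
  rw [Measure.addHaar_ball_of_pos volume q hr', finrank_euclideanSpace_fin,
    ENNReal.mul_inv (by simp [hr']) (by simp), ← ENNReal.ofReal_inv_of_pos (by positivity),
    ← mul_assoc, ← ENNReal.ofReal_mul hr.le]
  gcongr

theorem HasWeakGradientOn.edist_average_le (h : HasWeakGradientOn D u g)
    {p q : EuclideanSpace ℝ (Fin n)} {r r' A : ℝ} (hr0 : 0 < r) (hr : ball p r ⊆ D)
    (hr'0 : 0 < r') (hA : r ≤ A * r') (hsub : ball q r' ⊆ ball p r) :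
    edist (⨍ y in ball p r, u y) (⨍ y in ball q r', u y)
      ≤ poincareConst n * ENNReal.ofReal (A ^ n * r ^ (1 - (n : ℝ))) *
        ∫⁻ y in ball p r, ‖g y‖ₑ := by
  refine (h.edist_average_le_inv_volume hr0 hr hr'0 hsub).trans (mul_le_mul_left ?_ _)
  rw [mul_assoc, poincareConst, mul_assoc, mul_comm (volume _)⁻¹ (ENNReal.ofReal _)]
  refine mul_le_mul_right ?_ _
  exact ofReal_mul_inv_volume_ball_le hr0 hr'0 hA q

theorem HasWeakGradientOn.edist_average_adjacent_le (h : HasWeakGradientOn D u g)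
    {p q : EuclideanSpace ℝ (Fin n)} {ρ : ℝ} (hρ : 0 < ρ) (hpq : dist p q ≤ ρ)
    (hp : ball p (2 * ρ) ⊆ D) :
    edist (⨍ y in ball p ρ, u y) (⨍ y in ball q ρ, u y)
      ≤ 4 * poincareConst n * ENNReal.ofReal (ρ ^ (1 - (n : ℝ))) *
        ∫⁻ y in ball p (2 * ρ), ‖g y‖ₑ := by
  have hscale : (2 : ℝ) ^ n * (2 * ρ) ^ (1 - (n : ℝ)) = 2 * ρ ^ (1 - (n : ℝ)) := by
    rw [Real.mul_rpow two_pos.le hρ.le, Real.rpow_sub two_pos, Real.rpow_one, Real.rpow_natCast]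
    field_simp
  have hbig {z : EuclideanSpace ℝ (Fin n)} (hz : ball z ρ ⊆ ball p (2 * ρ)) :=
    h.edist_average_le (by positivity) hp hρ le_rfl hz
  have hpp := hbig (ball_subset_ball (by linarith))
  have hpq' := hbig (ball_subset_ball' (x := q) (y := p) (by linarith [dist_comm p q]))
  rw [hscale, ENNReal.ofReal_mul two_pos.le, ENNReal.ofReal_ofNat] at hpp hpq'
  rw [edist_comm] at hpp
  refine ((edist_triangle _ _ _).trans (add_le_add hpp hpq')).trans_eq ?_
  ring

theorem HasWeakGradientOn.edist_average_curve_le (h : HasWeakGradientOn D u g)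
    {γ : ℝ → EuclideanSpace ℝ (Fin n)} {a b ρ : ℝ} (hab : a ≤ b) (hρ : 0 < ρ)
    (hγ : LipschitzOnWith 1 γ (Icc a b)) {U : Set (EuclideanSpace ℝ (Fin n))} (hUD : U ⊆ D)
    (hball : ∀ t ∈ Icc a b, ball (γ t) (2 * ρ) ⊆ U) :
    edist (⨍ y in ball (γ a) ρ, u y) (⨍ y in ball (γ b) ρ, u y)
      ≤ 8 * 5 ^ n * poincareConst n * ENNReal.ofReal (ρ ^ (1 - (n : ℝ))) * ∫⁻ y in U, ‖g y‖ₑ := by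
  obtain ⟨m₀, c₀, hc₀⟩ := exists_isStepChain_of_lipschitzOnWith hab hρ hγ
  obtain ⟨m, c, hc, hsep⟩ := hc₀.exists_without_shortcut
  have hcU (i : ℕ) (hi : i ≤ m) : ball (c i) (2 * ρ) ⊆ U := by
    obtain ⟨t, ht, hti⟩ := hc.mem i hi
    exact hti ▸ hball t ht
  have hoverlap : ∑ i ∈ Finset.range m, ∫⁻ y in ball (c i) (2 * ρ), ‖g y‖ₑ
      ≤ (2 * 5 ^ n : ℕ) * ∫⁻ y in U, ‖g y‖ₑ := by
    refine sum_setLIntegral_le_of_card_le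
      (h.locallyIntegrable_grad.mono_set hUD).aestronglyMeasurable.enorm _
      (fun i => measurableSet_ball) (fun i hi => hcU i (Finset.mem_range.1 hi).le) _
      fun z J hJ hz => ?_
    simpa only [finrank_euclideanSpace_fin] using
      card_le_of_chain_without_shortcut hρ z hsep J hJ hz
  rw [← hc.apply_zero, ← hc.apply_length]
  calc edist (⨍ y in ball (c 0) ρ, u y) (⨍ y in ball (c m) ρ, u y)
      ≤ ∑ i ∈ Finset.range m,
          edist (⨍ y in ball (c i) ρ, u y) (⨍ y in ball (c (i + 1)) ρ, u y) :=
        edist_le_range_sum_edist (fun i => ⨍ y in ball (c i) ρ, u y) m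
    _ ≤ ∑ i ∈ Finset.range m, 4 * poincareConst n * ENNReal.ofReal (ρ ^ (1 - (n : ℝ))) *
          ∫⁻ y in ball (c i) (2 * ρ), ‖g y‖ₑ :=
        Finset.sum_le_sum fun i hi => h.edist_average_adjacent_le hρ
          (hc.dist_le i (Finset.mem_range.1 hi)) ((hcU i (Finset.mem_range.1 hi).le).trans hUD)
    _ = 4 * poincareConst n * ENNReal.ofReal (ρ ^ (1 - (n : ℝ))) *
          ∑ i ∈ Finset.range m, ∫⁻ y in ball (c i) (2 * ρ), ‖g y‖ₑ := (Finset.mul_sum _ _ _).symm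
    _ ≤ 4 * poincareConst n * ENNReal.ofReal (ρ ^ (1 - (n : ℝ))) *
          ((2 * 5 ^ n : ℕ) * ∫⁻ y in U, ‖g y‖ₑ) := by gcongr
    _ = _ := by
        push_cast
        ring

end Averages

theorem ball_infDist_frontier_subset {E : Type*} [NormedAddCommGroup E] [NormedSpace ℝ E]
    {D : Set E} (hD : IsOpen D) {y : E} (hy : y ∈ D) : ball y (infDist y (frontier D)) ⊆ D := by
  rcases le_or_gt (infDist y (frontier D)) 0 with hle | hpos
  · rw [ball_eq_empty.2 hle]
    exact empty_subset _
  have hconn : IsPreconnected (ball y (infDist y (frontier D))) :=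
    (convex_ball y _).isPreconnected
  refine hconn.subset_left_of_subset_union hD isOpen_interior
    (disjoint_compl_right.mono_right interior_subset) (fun z hz => ?_) ⟨y, mem_ball_self hpos, hy⟩
  have hz_frontier : z ∉ frontier D := fun h =>
    (mem_ball'.1 hz).not_ge (infDist_le_dist_of_mem h)
  by_cases hzD : z ∈ D
  · exact Or.inl hzD
  · rw [interior_compl]
    exact Or.inr fun hcl => hz_frontier ⟨hcl, by rwa [hD.interior_eq]⟩

theorem infDist_frontier_pos {E : Type*} [NormedAddCommGroup E] [NormedSpace ℝ E] [Nontrivial E]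
    {D : Set E} (hD : IsOpen D) (hb : Bornology.IsBounded D) {y : E} (hy : y ∈ D) :
    0 < infDist y (frontier D) := by
  have hne : (frontier D).Nonempty := by
    rw [nonempty_frontier_iff]
    refine ⟨⟨y, hy⟩, fun huniv => NormedSpace.unbounded_univ ℝ E ?_⟩
    rwa [huniv] at hb
  refine (isClosed_frontier.notMem_iff_infDist_pos hne).1 fun hyf => ?_
  exact (hD.inter_frontier_eq.subset ⟨hy, hyf⟩ : y ∈ (∅ : Set E))

theorem lipschitzOnWith_of_hasUnitSpeedOn {E : Type*} [PseudoMetricSpace E] {γ : ℝ → E}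
    {A : Set ℝ} (h : HasUnitSpeedOn γ A) : LipschitzOnWith 1 γ A := by
  intro t ht t' ht'
  wlog hle : t ≤ t' generalizing t t'
  · rw [edist_comm, edist_comm t]
    exact this ht' ht (le_of_not_ge hle)
  calc edist (γ t) (γ t') ≤ eVariationOn γ (A ∩ Icc t t') :=
        eVariationOn.edist_le γ ⟨ht, left_mem_Icc.2 hle⟩ ⟨ht', right_mem_Icc.2 hle⟩
    _ = ENNReal.ofReal (t' - t) := by simpa using h ht ht'
    _ = (1 : NNReal) * edist t t' := by
        rw [edist_comm, edist_dist, Real.dist_eq, abs_of_nonneg (sub_nonneg.2 hle)]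
        simp

/-- `γ` is a curve from `x` to `x₀` as in the definition of a `σ`-John domain `D`. It is only
required to be `1`-Lipschitz, so that after reaching `x₀` it may stay there: this allows all the
curves of a John domain to have the same parameter interval `[0, R]`. -/
structure IsJohnCurve {E : Type*} [PseudoMetricSpace E] (D : Set E) (σ K R : ℝ) (x x₀ : E)
    (γ : ℝ → E) : Prop where
  lipschitz : LipschitzOnWith 1 γ (Icc 0 R)
  mapsTo : MapsTo γ (Icc 0 R) D
  source : γ 0 = x
  target : γ R = x₀
  rpow_le : ∀ t ∈ Icc 0 R, t ^ σ ≤ K * infDist (γ t) (frontier D)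

theorem IsJohnCurve.extend {E : Type*} [PseudoMetricSpace E] {D : Set E} {σ K K' L R : ℝ}
    {x x₀ : E} {γ : ℝ → E} (h : IsJohnCurve D σ K L x x₀ γ) (hσ : 0 ≤ σ) (hL : 0 ≤ L)
    (hLR : L ≤ R) (hKK' : K ≤ K') (hR : R ^ σ ≤ K' * infDist x₀ (frontier D)) :
    IsJohnCurve D σ K' R x x₀ (fun t => γ (min t L)) := by
  have hmem : MapsTo (min · L) (Icc 0 R) (Icc 0 L) := fun t ht =>
    ⟨le_min ht.1 hL, min_le_right _ _⟩
  refine ⟨?_, h.mapsTo.comp hmem, by rw [min_eq_left hL, h.source],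
    by rw [min_eq_right hLR, h.target], fun t ht => ?_⟩
  · simpa [Function.comp_def] using
      h.lipschitz.comp (LipschitzWith.id.min_const L).lipschitzOnWith hmem
  rcases le_total t L with htL | htL
  · rw [min_eq_left htL]
    exact (h.rpow_le t ⟨ht.1, htL⟩).trans
      (mul_le_mul_of_nonneg_right hKK' infDist_nonneg)
  · rw [min_eq_right htL, h.target]
    exact (Real.rpow_le_rpow ht.1 ht.2 hσ).trans hR

theorem IsVarJohnDomain.exists_isJohnCurve {n : ℕ} [NeZero n] {D : Set (EuclideanSpace ℝ (Fin n))}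
    {s : EuclideanSpace ℝ (Fin n) → ℝ} {x₀ : EuclideanSpace ℝ (Fin n)}
    (hD : IsVarJohnDomain D s x₀) {S : ℝ} (hsS : ∀ x ∈ D, s x ≤ S) :
    ∃ R K : ℝ, 1 ≤ R ∧ 1 ≤ K ∧ (∀ x ∈ D, D ⊆ ball x R) ∧
      ∀ x ∈ D, ∃ γ, IsJohnCurve D (s x) K R x x₀ γ := by
  obtain ⟨a, b, h⟩ := hD
  set d₀ := infDist x₀ (frontier D)
  have hd₀ : 0 < d₀ := infDist_frontier_pos h.isOpen h.isBounded h.center_mem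
  set R := max (max 1 b) (diam D + 1)
  have one_le_R : 1 ≤ R := (le_max_left _ _).trans (le_max_left _ _)
  have b_le_R : b ≤ R := (le_max_right _ _).trans (le_max_left _ _)
  have diam_lt_R : diam D < R := (lt_add_one _).trans_le (le_max_right _ _)
  set K := max (max 1 (b / a)) (R ^ S / d₀)
  have b_div_a_le_K : b / a ≤ K := (le_max_right _ _).trans (le_max_left _ _)
  refine ⟨R, K, one_le_R, (le_max_left _ _).trans (le_max_left _ _),
    fun x hx y hy => (dist_le_diam_of_mem h.isBounded hy hx).trans_lt diam_lt_R, fun x hx => ?_⟩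
  obtain ⟨L, γ, hL, hLb, hspeed, hmaps, hγ0, hγL, hrpow⟩ := h.exists_curve x hx
  have hγ : IsJohnCurve D (s x) (b / a) L x x₀ γ :=
    ⟨lipschitzOnWith_of_hasUnitSpeedOn hspeed, hmaps, hγ0, hγL, hrpow⟩
  refine ⟨_, hγ.extend (zero_le_one.trans (h.one_le x hx)) hL (hLb.trans b_le_R) b_div_a_le_K ?_⟩
  calc R ^ s x ≤ R ^ S := Real.rpow_le_rpow_of_exponent_le one_le_R (hsS x hx)
    _ ≤ K * d₀ := (div_le_iff₀ hd₀).1 (le_max_right _ _)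

theorem IsJohnCurve.dist_source_le {E : Type*} [PseudoMetricSpace E] {D : Set E} {σ K R : ℝ}
    {x x₀ : E} {γ : ℝ → E} (h : IsJohnCurve D σ K R x x₀ γ) {t : ℝ} (ht : t ∈ Icc 0 R) :
    dist (γ t) x ≤ t := by
  have := h.lipschitz.dist_le_mul t ht 0 ⟨le_rfl, ht.1.trans ht.2⟩
  rwa [h.source, NNReal.coe_one, one_mul, Real.dist_eq, sub_zero, abs_of_nonneg ht.1] at this

theorem exists_dyadic_index {r₀ : ℝ} (hr₀ : 0 < r₀) :
    ∃ J : ℝ → ℕ, Tendsto J (𝓝[>] 0) atTop ∧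
      ∀ᶠ r in 𝓝[>] 0, r ∈ Icc (r₀ * (1 / 2) ^ (J r + 1)) (r₀ * (1 / 2) ^ J r) := by
  refine ⟨fun r => ⌊Real.logb 2 (r₀ / r)⌋₊, ?_, ?_⟩
  · exact tendsto_nat_floor_atTop.comp ((Real.tendsto_logb_atTop one_lt_two).comp
      (tendsto_inv_nhdsGT_zero.const_mul_atTop hr₀))
  filter_upwards [Ioo_mem_nhdsGT hr₀] with r ⟨hr, hr_lt⟩
  have hpow : (2 : ℝ) ^ Real.logb 2 (r₀ / r) = r₀ / r :=
    Real.rpow_logb two_pos (by norm_num) (div_pos hr₀ hr)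
  have hlog : 0 ≤ Real.logb 2 (r₀ / r) := Real.logb_nonneg one_lt_two ((one_le_div hr).2 hr_lt.le)
  rw [one_div_pow, one_div_pow, mul_one_div, mul_one_div]
  constructor
  · rw [div_le_comm₀ (by positivity) hr, ← Real.rpow_natCast]
    exact hpow.symm.trans_le (Real.rpow_le_rpow_of_exponent_le one_le_two
      (by exact_mod_cast (Nat.lt_floor_add_one _).le))
  · rw [le_div_comm₀ hr (by positivity), ← Real.rpow_natCast]
    exact (Real.rpow_le_rpow_of_exponent_le one_le_two (Nat.floor_le hlog)).trans_eq hpow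

theorem exists_tendsto_nhdsGT_zero_of_dyadic {X : Type*} [PseudoEMetricSpace X] [CompleteSpace X]
    {F : ℝ → X} {r₀ : ℝ} (hr₀ : 0 < r₀) {a : ℕ → ℝ≥0∞} (ha : ∑' j, a j ≠ ⊤)
    (hF : ∀ᶠ j in atTop, ∀ r ∈ Icc (r₀ * (1 / 2) ^ (j + 1)) (r₀ * (1 / 2) ^ j),
      edist (F (r₀ * (1 / 2) ^ j)) (F r) ≤ a j) :
    ∃ l, Tendsto F (𝓝[>] 0) (𝓝 l) := by
  obtain ⟨j₀, hj₀⟩ := eventually_atTop.1 hF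
  have hstep : ∀ k, edist (F (r₀ * (1 / 2) ^ (k + j₀))) (F (r₀ * (1 / 2) ^ (k.succ + j₀)))
      ≤ a (k + j₀) := fun k => by
    rw [Nat.succ_add]
    refine hj₀ (k + j₀) le_add_self _ ⟨le_rfl, mul_le_mul_of_nonneg_left ?_ hr₀.le⟩
    exact pow_le_pow_of_le_one (by norm_num) (by norm_num) (Nat.le_succ _)
  have hsum : ∑' k, a (k + j₀) ≠ ⊤ :=
    ne_top_of_le_ne_top ha (ENNReal.tsum_comp_le_tsum_of_injective (add_left_injective j₀) a)
  obtain ⟨l, hl⟩ :=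
    cauchySeq_tendsto_of_complete (cauchySeq_of_edist_le_of_tsum_ne_top _ hstep hsum)
  have hl' : Tendsto (fun j => F (r₀ * (1 / 2) ^ j)) atTop (𝓝 l) :=
    (tendsto_add_atTop_iff_nat j₀).1 hl
  obtain ⟨J, hJ, hbracket⟩ := exists_dyadic_index hr₀
  have hlim : Tendsto (fun r => a (J r) + edist (F (r₀ * (1 / 2) ^ J r)) l) (𝓝[>] 0) (𝓝 0) := by
    simpa using ((ENNReal.tendsto_atTop_zero_of_tsum_ne_top ha).comp hJ).add
      ((tendsto_iff_edist_tendsto_0.1 hl').comp hJ)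
  refine ⟨l, tendsto_iff_edist_tendsto_0.2 (tendsto_of_tendsto_of_tendsto_of_le_of_le'
    tendsto_const_nhds hlim (Eventually.of_forall fun _ => zero_le) ?_)⟩
  filter_upwards [hbracket, hJ.eventually hF] with r hr hFr
  refine (edist_triangle _ (F (r₀ * (1 / 2) ^ J r)) _).trans (add_le_add_left ?_ _)
  rw [edist_comm]
  exact hFr r hr

/-- The scale `r` term `r ^ (-β) ∫_{B(x, r)} f dμ` of the dyadic potential. -/
def scaledBallIntegral {E : Type*} [PseudoMetricSpace E] [MeasurableSpace E] (μ : Measure E)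
    (f : E → ℝ≥0∞) (β : ℝ) (x : E) (r : ℝ) : ℝ≥0∞ :=
  ENNReal.ofReal (r ^ (-β)) * ∫⁻ y in ball x r, f y ∂μ

/-- The dyadic form, over the scales `r₀ 2 ^ (-j)`, of the Riesz type potential
`∫_{B(x, r₀)} f(y) |x - y| ^ (-β) dμ(y)`. -/
def dyadicPotential {E : Type*} [PseudoMetricSpace E] [MeasurableSpace E] (μ : Measure E)
    (f : E → ℝ≥0∞) (r₀ β : ℝ) (x : E) : ℝ≥0∞ :=
  ∑' j : ℕ, scaledBallIntegral μ f β x (r₀ * (1 / 2) ^ j)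

theorem scaledBallIntegral_le_dyadicPotential {E : Type*} [PseudoMetricSpace E]
    [MeasurableSpace E] (μ : Measure E) (f : E → ℝ≥0∞) (r₀ β : ℝ) (x : E) (j : ℕ) :
    scaledBallIntegral μ f β x (r₀ * (1 / 2) ^ j) ≤ dyadicPotential μ f r₀ β x :=
  ENNReal.le_tsum j

theorem scaledBallIntegral_self_le_dyadicPotential {E : Type*} [PseudoMetricSpace E]
    [MeasurableSpace E] (μ : Measure E) (f : E → ℝ≥0∞) (r₀ β : ℝ) (x : E) :
    scaledBallIntegral μ f β x r₀ ≤ dyadicPotential μ f r₀ β x := by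
  simpa using scaledBallIntegral_le_dyadicPotential μ f r₀ β x 0

theorem tendsto_preciseRep {E : Type*} [MetricSpace E] [MeasureSpace E] {u : E → ℝ} {x : E}
    (h : ∃ l : ℝ, Tendsto (fun r : ℝ => ⨍ y in ball x r, u y) (𝓝[>] 0) (𝓝 l)) :
    Tendsto (fun r : ℝ => ⨍ y in ball x r, u y) (𝓝[>] 0) (𝓝 (preciseRep u x)) := by
  rw [preciseRep, dif_pos h]
  exact h.choose_spec

/-- The power `r ^ (1 - n)` coming from the Poincaré inequality is traded for `R ^ (-β)`. -/
theorem HasWeakGradientOn.edist_average_le_scaledBallIntegral {n : ℕ}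
    {D : Set (EuclideanSpace ℝ (Fin n))}
    {u : EuclideanSpace ℝ (Fin n) → ℝ} {g : EuclideanSpace ℝ (Fin n) → EuclideanSpace ℝ (Fin n)}
    (h : HasWeakGradientOn D u g) {p q x : EuclideanSpace ℝ (Fin n)} {r r' A R β Λ : ℝ}
    (hr : 0 < r) (hpD : ball p r ⊆ D) (hr' : 0 < r') (hA : r ≤ A * r')
    (hqp : ball q r' ⊆ ball p r) (hpx : ball p r ⊆ ball x R) (hΛ : 0 ≤ Λ)
    (hrR : r ^ (1 - (n : ℝ)) ≤ Λ * R ^ (-β)) :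
    edist (⨍ y in ball p r, u y) (⨍ y in ball q r', u y)
      ≤ poincareConst n * ENNReal.ofReal (A ^ n * Λ) *
        scaledBallIntegral (volume.restrict D) (‖g ·‖ₑ) β x R := by
  have hA0 : 0 ≤ A := (pos_of_mul_pos_left (hr.trans_le hA) hr'.le).le
  refine (h.edist_average_le hr hpD hr' hA hqp).trans ?_
  rw [scaledBallIntegral, Measure.restrict_restrict measurableSet_ball, ← mul_assoc,
    mul_assoc _ (ENNReal.ofReal (A ^ n * Λ)), ← ENNReal.ofReal_mul (by positivity)]
  refine mul_le_mul' (mul_le_mul' le_rfl (ENNReal.ofReal_le_ofReal ?_))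
    (lintegral_mono_set (subset_inter hpx hpD))
  rw [mul_assoc]
  exact mul_le_mul_of_nonneg_left hrR (by positivity)

theorem HasWeakGradientOn.tendsto_preciseRep_of_dyadicPotential_ne_top {n : ℕ}
    {D : Set (EuclideanSpace ℝ (Fin n))}
    {u : EuclideanSpace ℝ (Fin n) → ℝ} {g : EuclideanSpace ℝ (Fin n) → EuclideanSpace ℝ (Fin n)}
    (h : HasWeakGradientOn D u g) {x : EuclideanSpace ℝ (Fin n)} (hx : D ∈ 𝓝 x) {r₀ β : ℝ}
    (hr₀ : 0 < r₀) (hβ : (n : ℝ) - 1 ≤ β)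
    (hfin : dyadicPotential (volume.restrict D) (‖g ·‖ₑ) r₀ β x ≠ ⊤) :
    Tendsto (fun r : ℝ => ⨍ y in ball x r, u y) (𝓝[>] 0) (𝓝 (preciseRep u x)) := by
  obtain ⟨d, hd, hdD⟩ := Metric.mem_nhds_iff.1 hx
  have hscale : Tendsto (fun j : ℕ => r₀ * (1 / 2 : ℝ) ^ j) atTop (𝓝 0) := by
    simpa using (tendsto_pow_atTop_nhds_zero_of_lt_one (r := (1 / 2 : ℝ)) (by norm_num)
      (by norm_num)).const_mul r₀
  set C := poincareConst n * ENNReal.ofReal (2 ^ n * r₀ ^ (β - (n - 1)))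
  have hC : C ≠ ⊤ := ENNReal.mul_ne_top (poincareConst_ne_top n) ENNReal.ofReal_ne_top
  refine tendsto_preciseRep (exists_tendsto_nhdsGT_zero_of_dyadic hr₀
    (a := fun j => C * scaledBallIntegral (volume.restrict D) (‖g ·‖ₑ) β x (r₀ * (1 / 2) ^ j))
    ?_ ?_)
  · rw [ENNReal.tsum_mul_left]
    exact ENNReal.mul_ne_top hC hfin
  filter_upwards [hscale.eventually_lt_const hd] with j hj r ⟨hr_ge, hr_le⟩
  have hpos : 0 < r₀ * (1 / 2 : ℝ) ^ j := by positivity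
  have hr_half : r₀ * (1 / 2) ^ j ≤ 2 * r := by
    rw [pow_succ] at hr_ge
    linarith
  refine h.edist_average_le_scaledBallIntegral hpos ((ball_subset_ball hj.le).trans hdD)
    (by linarith) hr_half (ball_subset_ball hr_le) subset_rfl (by positivity) ?_
  calc (r₀ * (1 / 2) ^ j) ^ (1 - (n : ℝ))
      = (r₀ * (1 / 2) ^ j) ^ (β - (n - 1)) * (r₀ * (1 / 2) ^ j) ^ (-β) := by
        rw [← Real.rpow_add hpos]
        congr 1
        ring
    _ ≤ r₀ ^ (β - (n - 1)) * (r₀ * (1 / 2) ^ j) ^ (-β) := by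
        refine mul_le_mul_of_nonneg_right ?_ (by positivity)
        exact Real.rpow_le_rpow hpos.le (mul_le_of_le_one_right hr₀.le
          (pow_le_one₀ (by norm_num) (by norm_num))) (sub_nonneg.2 hβ)

/-- The radius of the balls `B(γ t, ·)`, `T / 2 ≤ t ≤ T`, in the chain along a `σ`-John curve `γ`
with constant `K`. For `σ ≤ S` their doubles stay inside the domain. -/
def johnRadius (S K σ T : ℝ) : ℝ := T ^ σ / (2 ^ (S + 1) * K)

section JohnRadius

variable {S K R σ T : ℝ}

theorem johnRadius_pos (hK : 0 < K) (hT : 0 < T) : 0 < johnRadius S K σ T := by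
  unfold johnRadius
  positivity

theorem two_mul_johnRadius : 2 * johnRadius S K σ T = T ^ σ / (2 ^ S * K) := by
  rw [johnRadius, Real.rpow_add_one two_ne_zero]
  field_simp

theorem two_mul_johnRadius_le_rpow (hK : 1 ≤ K) (hS : 0 ≤ S) (hT : 0 ≤ T) :
    2 * johnRadius S K σ T ≤ T ^ σ := by
  rw [two_mul_johnRadius]
  exact div_le_self (Real.rpow_nonneg hT _)
    (one_le_mul_of_one_le_of_one_le (Real.one_le_rpow one_le_two hS) hK)

theorem add_two_mul_johnRadius_le (hR : 1 ≤ R) (hK : 1 ≤ K) (hσ : σ ∈ Icc 1 S)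
    (hT : T ∈ Ioc 0 R) : T + 2 * johnRadius S K σ T ≤ 2 * R ^ (S - 1) * T := by
  have hone : 1 ≤ R ^ (S - 1) := Real.one_le_rpow hR (by linarith [hσ.1, hσ.2])
  have hrpow : T ^ σ ≤ R ^ (S - 1) * T :=
    calc T ^ σ = T ^ (σ - 1) * T := by rw [← Real.rpow_add_one hT.1.ne', sub_add_cancel]
      _ ≤ R ^ (σ - 1) * T := mul_le_mul_of_nonneg_right
          (Real.rpow_le_rpow hT.1.le hT.2 (sub_nonneg.2 hσ.1)) hT.1.le
      _ ≤ R ^ (S - 1) * T := mul_le_mul_of_nonneg_right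
          (Real.rpow_le_rpow_of_exponent_le hR (sub_le_sub_right hσ.2 1)) hT.1.le
  have hradius := two_mul_johnRadius_le_rpow (σ := σ) hK
    (zero_le_one.trans (hσ.1.trans hσ.2)) hT.1.le
  nlinarith [hT.1]

theorem tendsto_johnRadius_nhdsGT_zero (hK : 0 < K) (hσ : 0 < σ) :
    Tendsto (johnRadius S K σ) (𝓝[>] 0) (𝓝[>] 0) := by
  refine tendsto_nhdsWithin_iff.2
    ⟨?_, eventually_mem_nhdsWithin.mono fun T hT => johnRadius_pos hK hT⟩
  have h : Tendsto (fun T : ℝ => T ^ σ / (2 ^ (S + 1) * K)) (𝓝 0) (𝓝 0) := by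
    simpa [Real.zero_rpow hσ.ne'] using
      ((tendsto_id (α := ℝ) (x := 𝓝 0)).rpow_const (Or.inr hσ.le)).div_const (2 ^ (S + 1) * K)
  exact h.mono_left nhdsWithin_le_nhds

theorem johnRadius_half_le (hK : 0 < K) (hσ : 0 ≤ σ) (hT : 0 ≤ T) :
    johnRadius S K σ (T / 2) ≤ johnRadius S K σ T := by
  unfold johnRadius
  gcongr
  exact half_le_self hT

theorem johnRadius_le_mul_johnRadius_half (hK : 0 < K) (hσS : σ ≤ S) (hT : 0 ≤ T) :
    johnRadius S K σ T ≤ 2 ^ S * johnRadius S K σ (T / 2) := by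
  have hrpow : T ^ σ ≤ 2 ^ S * (T / 2) ^ σ := by
    rw [Real.div_rpow hT two_pos.le, mul_div_assoc', le_div_iff₀ (by positivity), mul_comm]
    gcongr
    norm_num
  unfold johnRadius
  rw [mul_div_assoc']
  gcongr

/-- The constant in the comparison of `johnRadius S K σ T ^ (-d)` with
`(2 * R ^ (S - 1) * T) ^ (-(σ * d))`. -/
def johnRadiusConst (S K R d : ℝ) : ℝ := (2 ^ (S + 1) * K) ^ d * (2 * R ^ (S - 1)) ^ (S * d)

theorem johnRadiusConst_nonneg (hK : 0 ≤ K) (hR : 0 ≤ R) (d : ℝ) :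
    0 ≤ johnRadiusConst S K R d := by
  unfold johnRadiusConst
  positivity

theorem johnRadius_rpow_neg_le (hR : 1 ≤ R) (hK : 0 < K) (hσ : σ ∈ Icc 1 S) (hT : 0 < T)
    {d : ℝ} (hd : 0 ≤ d) :
    johnRadius S K σ T ^ (-d) ≤ johnRadiusConst S K R d * (2 * R ^ (S - 1) * T) ^ (-(σ * d)) := by
  have hb : 1 ≤ 2 * R ^ (S - 1) := one_le_mul_of_one_le_of_one_le one_le_two
    (Real.one_le_rpow hR (by linarith [hσ.1, hσ.2]))
  have hb0 : 0 < 2 * R ^ (S - 1) := zero_lt_one.trans_le hb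
  calc johnRadius S K σ T ^ (-d)
      = (2 ^ (S + 1) * K) ^ d * T ^ (-(σ * d)) := by
        rw [johnRadius, Real.div_rpow (by positivity) (by positivity), ← Real.rpow_mul hT.le,
          Real.rpow_neg (by positivity), div_inv_eq_mul, mul_comm, mul_neg]
    _ ≤ (2 ^ (S + 1) * K) ^ d *
          ((2 * R ^ (S - 1)) ^ (S * d) * (2 * R ^ (S - 1)) ^ (-(σ * d)) * T ^ (-(σ * d))) := by
        refine mul_le_mul_of_nonneg_left (le_mul_of_one_le_left (by positivity) ?_)
          (by positivity)
        rw [← Real.rpow_add hb0]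
        exact Real.one_le_rpow hb (by nlinarith [hσ.2])
    _ = johnRadiusConst S K R d * (2 * R ^ (S - 1) * T) ^ (-(σ * d)) := by
        rw [johnRadiusConst, Real.mul_rpow hb0.le hT.le]
        ring

theorem IsJohnCurve.ball_two_mul_johnRadius_subset {E : Type*} [NormedAddCommGroup E]
    [NormedSpace ℝ E] {D : Set E} (hD : IsOpen D) {x x₀ : E} {γ : ℝ → E}
    (hγ : IsJohnCurve D σ K R x x₀ γ) (hK : 0 < K) (hσ : 0 ≤ σ) (hσS : σ ≤ S) (hT : T ∈ Ioc 0 R)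
    {t : ℝ} (ht : t ∈ Icc (T / 2) T) : ball (γ t) (2 * johnRadius S K σ T) ⊆ D := by
  have ht0 : 0 ≤ t := (half_pos hT.1).le.trans ht.1
  have htR : t ∈ Icc 0 R := ⟨ht0, ht.2.trans hT.2⟩
  refine (ball_subset_ball ?_).trans (ball_infDist_frontier_subset hD (hγ.mapsTo htR))
  rw [two_mul_johnRadius, div_le_iff₀ (by positivity)]
  calc T ^ σ ≤ (2 * t) ^ σ := Real.rpow_le_rpow hT.1.le (by linarith [ht.1]) hσ
    _ = 2 ^ σ * t ^ σ := Real.mul_rpow two_pos.le ht0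
    _ ≤ 2 ^ S * (K * infDist (γ t) (frontier D)) := by
        gcongr
        · norm_num
        · exact hγ.rpow_le t htR
    _ = infDist (γ t) (frontier D) * (2 ^ S * K) := by ring

end JohnRadius

section JohnCurve

variable {n : ℕ} [NeZero n] {D : Set (EuclideanSpace ℝ (Fin n))}
  {u : EuclideanSpace ℝ (Fin n) → ℝ} {g : EuclideanSpace ℝ (Fin n) → EuclideanSpace ℝ (Fin n)}
  {S K R σ T : ℝ} {x x₀ : EuclideanSpace ℝ (Fin n)} {γ : ℝ → EuclideanSpace ℝ (Fin n)}

/-- The constant of the chaining estimate along a piece of a John curve at a single scale. -/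
def johnChainConst (n : ℕ) (S K R : ℝ) : ℝ≥0∞ :=
  8 * 5 ^ n * poincareConst n * ENNReal.ofReal (johnRadiusConst S K R (n - 1))

theorem johnChainConst_ne_top (n : ℕ) (S K R : ℝ) : johnChainConst n S K R ≠ ⊤ := by
  have := poincareConst_ne_top n
  unfold johnChainConst
  finiteness

theorem HasWeakGradientOn.edist_average_johnCurve_le (h : HasWeakGradientOn D u g)
    (hγ : IsJohnCurve D σ K R x x₀ γ) (hR : 1 ≤ R) (hK : 1 ≤ K) (hσ : σ ∈ Icc 1 S)
    (hT : T ∈ Ioc 0 R) {t : ℝ} (ht : t ∈ Icc 0 T)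
    (hball : ∀ t' ∈ Icc t T, ball (γ t') (2 * johnRadius S K σ T) ⊆ D) :
    edist (⨍ y in ball (γ t) (johnRadius S K σ T), u y)
        (⨍ y in ball (γ T) (johnRadius S K σ T), u y)
      ≤ johnChainConst n S K R *
        scaledBallIntegral (volume.restrict D) (‖g ·‖ₑ) (σ * (n - 1)) x (2 * R ^ (S - 1) * T) := by
  have hK0 : 0 < K := zero_lt_one.trans_le hK
  have hn : (0 : ℝ) ≤ n - 1 := sub_nonneg.2 (Nat.one_le_cast.2 NeZero.one_le)
  have hsub : Icc t T ⊆ Icc 0 R := Icc_subset_Icc ht.1 hT.2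
  have hpow : johnRadius S K σ T ^ (1 - (n : ℝ))
      ≤ johnRadiusConst S K R (n - 1) * (2 * R ^ (S - 1) * T) ^ (-(σ * ((n : ℝ) - 1))) := by
    simpa only [neg_sub] using johnRadius_rpow_neg_le hR hK0 hσ hT.1 hn
  refine (h.edist_average_curve_le ht.2 (johnRadius_pos hK0 hT.1) (hγ.lipschitz.mono hsub)
    (U := ball x (2 * R ^ (S - 1) * T) ∩ D) inter_subset_right fun t' ht' =>
      subset_inter (ball_subset_ball' ?_) (hball t' ht')).trans ?_
  · linarith [hγ.dist_source_le (hsub ht'), ht'.2, add_two_mul_johnRadius_le hR hK hσ hT]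
  · rw [scaledBallIntegral, Measure.restrict_restrict measurableSet_ball, ← mul_assoc,
      johnChainConst, mul_assoc _ (ENNReal.ofReal (johnRadiusConst _ _ _ _)),
      ← ENNReal.ofReal_mul (johnRadiusConst_nonneg hK0.le (zero_le_one.trans hR) _)]
    exact mul_le_mul' (mul_le_mul' le_rfl (ENNReal.ofReal_le_ofReal hpow)) le_rfl

/-- The average of `u` over the ball of radius `johnRadius S K σ T` centred at `γ T`. -/
def johnAverage (u : EuclideanSpace ℝ (Fin n) → ℝ) (γ : ℝ → EuclideanSpace ℝ (Fin n))
    (S K σ T : ℝ) : ℝ :=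
  ⨍ y in ball (γ T) (johnRadius S K σ T), u y

theorem HasWeakGradientOn.edist_johnAverage_half_le (h : HasWeakGradientOn D u g) (hD : IsOpen D)
    (hγ : IsJohnCurve D σ K R x x₀ γ) (hR : 1 ≤ R) (hK : 1 ≤ K) (hσ : σ ∈ Icc 1 S)
    (hT : T ∈ Ioc 0 R) :
    edist (johnAverage u γ S K σ T) (johnAverage u γ S K σ (T / 2))
      ≤ (johnChainConst n S K R +
          poincareConst n * ENNReal.ofReal ((2 ^ S) ^ n * johnRadiusConst S K R (n - 1))) *
        scaledBallIntegral (volume.restrict D) (‖g ·‖ₑ) (σ * (n - 1)) x (2 * R ^ (S - 1) * T) := by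
  have hK0 : 0 < K := zero_lt_one.trans_le hK
  have hσ0 : 0 ≤ σ := zero_le_one.trans hσ.1
  have hn : (0 : ℝ) ≤ n - 1 := sub_nonneg.2 (Nat.one_le_cast.2 NeZero.one_le)
  have hhalf : T / 2 ∈ Icc 0 T := ⟨(half_pos hT.1).le, half_le_self hT.1.le⟩
  have hrad := johnRadius_pos (S := S) (σ := σ) hK0 hT.1
  have htube {t : ℝ} (ht : t ∈ Icc (T / 2) T) : ball (γ t) (2 * johnRadius S K σ T) ⊆ D :=
    hγ.ball_two_mul_johnRadius_subset hD hK0 hσ0 hσ.2 hT ht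
  have hmove := h.edist_average_johnCurve_le hγ hR hK hσ hT hhalf fun t ht => htube ht
  have hshrink := h.edist_average_le_scaledBallIntegral (x := x) (β := σ * ((n : ℝ) - 1))
    (R := 2 * R ^ (S - 1) * T) (q := γ (T / 2)) hrad
    ((ball_subset_ball (by linarith)).trans (htube (left_mem_Icc.2 hhalf.2)))
    (johnRadius_pos hK0 (half_pos hT.1))
    (johnRadius_le_mul_johnRadius_half hK0 hσ.2 hT.1.le)
    (ball_subset_ball (johnRadius_half_le hK0 hσ0 hT.1.le))
    (ball_subset_ball' (by
      linarith [hγ.dist_source_le ⟨hhalf.1, hhalf.2.trans hT.2⟩,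
        hhalf.2, add_two_mul_johnRadius_le hR hK hσ hT]))
    (johnRadiusConst_nonneg hK0.le (zero_le_one.trans hR) (n - 1))
    (by simpa only [neg_sub] using johnRadius_rpow_neg_le hR hK0 hσ hT.1 hn)
  rw [edist_comm] at hmove
  rw [add_mul]
  exact (edist_triangle _ _ _).trans (add_le_add hmove hshrink)

theorem HasWeakGradientOn.edist_johnAverage_center_le (h : HasWeakGradientOn D u g)
    (hD : IsOpen D) (hγ : IsJohnCurve D σ K R x x₀ γ) (hR : 1 ≤ R) (hK : 1 ≤ K)
    (hσ : σ ∈ Icc 1 S) (hDx : D ⊆ ball x R) {d₀ : ℝ} (hd₀ : d₀ = infDist x₀ (frontier D)) :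
    edist (johnAverage u γ S K σ R) (⨍ y in ball x₀ d₀, u y)
      ≤ poincareConst n * ENNReal.ofReal ((d₀ * (2 ^ (S + 1) * K)) ^ n *
          (d₀ ^ (1 - (n : ℝ)) * (2 * R ^ (S - 1) * R) ^ (S * (n - 1)))) *
        scaledBallIntegral (volume.restrict D) (‖g ·‖ₑ) (σ * (n - 1)) x (2 * R ^ (S - 1) * R) := by
  have hK0 : 0 < K := zero_lt_one.trans_le hK
  have hR0 : 0 < R := zero_lt_one.trans_le hR
  have hn : (0 : ℝ) ≤ n - 1 := sub_nonneg.2 (Nat.one_le_cast.2 NeZero.one_le)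
  have hRmem : R ∈ Icc 0 R := ⟨hR0.le, le_rfl⟩
  have hRσ : 1 ≤ R ^ σ := Real.one_le_rpow hR (zero_le_one.trans hσ.1)
  have hbR : R ≤ 2 * R ^ (S - 1) * R := by
    linarith [add_two_mul_johnRadius_le hR hK hσ ⟨hR0, le_rfl⟩,
      johnRadius_pos (S := S) (σ := σ) hK0 hR0]
  have hx₀ : x₀ ∈ D := hγ.target ▸ hγ.mapsTo hRmem
  have hK_d₀ : R ^ σ ≤ K * d₀ := by simpa only [hγ.target, ← hd₀] using hγ.rpow_le R hRmem
  have hd₀_pos : 0 < d₀ := pos_of_mul_pos_right (zero_lt_one.trans_le (hRσ.trans hK_d₀)) hK0.le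
  have hball : ball x₀ d₀ ⊆ D := hd₀ ▸ ball_infDist_frontier_subset hD hx₀
  rw [edist_comm, johnAverage, hγ.target]
  refine h.edist_average_le_scaledBallIntegral hd₀_pos hball (johnRadius_pos hK0 hR0) ?_
    (ball_subset_ball ?_) ((hball.trans hDx).trans (ball_subset_ball hbR)) (by positivity) ?_
  · rw [johnRadius, mul_assoc, mul_div_cancel₀ _ (by positivity)]
    exact le_mul_of_one_le_right hd₀_pos.le hRσ
  · rw [johnRadius, div_le_iff₀ (by positivity)]
    have : 1 ≤ (2 : ℝ) ^ (S + 1) := Real.one_le_rpow one_le_two (by linarith [hσ.1, hσ.2])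
    nlinarith
  · rw [mul_assoc, ← Real.rpow_add (by positivity)]
    refine le_mul_of_one_le_right (by positivity) (Real.one_le_rpow (hR.trans hbR) ?_)
    nlinarith [hσ.2]

theorem HasWeakGradientOn.eventually_edist_average_johnAverage_le (h : HasWeakGradientOn D u g)
    (hγ : IsJohnCurve D σ K R x x₀ γ) (hR : 1 ≤ R) (hK : 1 ≤ K) (hσ : σ ∈ Icc 1 S)
    (hx : D ∈ 𝓝 x) :
    ∀ᶠ T in 𝓝[>] 0, edist (⨍ y in ball x (johnRadius S K σ T), u y) (johnAverage u γ S K σ T)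
      ≤ johnChainConst n S K R *
        scaledBallIntegral (volume.restrict D) (‖g ·‖ₑ) (σ * (n - 1)) x (2 * R ^ (S - 1) * T) := by
  obtain ⟨d, hd, hdD⟩ := Metric.mem_nhds_iff.1 hx
  have hlim : Tendsto (fun T : ℝ => 2 * R ^ (S - 1) * T) (𝓝[>] 0) (𝓝 0) := by
    simpa using (tendsto_id.const_mul (2 * R ^ (S - 1))).mono_left
      (nhdsWithin_le_nhds (a := (0 : ℝ)) (s := Ioi 0))
  filter_upwards [hlim.eventually_lt_const hd, Ioc_mem_nhdsGT (zero_lt_one.trans_le hR)]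
    with T hTd hT
  have hchain := h.edist_average_johnCurve_le hγ hR hK hσ hT (t := 0) ⟨le_rfl, hT.1.le⟩
    fun t ht => (ball_subset_ball' ?_).trans hdD
  · rwa [hγ.source] at hchain
  · linarith [hγ.dist_source_le ⟨ht.1, ht.2.trans hT.2⟩, ht.2,
      add_two_mul_johnRadius_le hR hK hσ hT]

theorem HasWeakGradientOn.edist_johnAverage_dyadic_le (h : HasWeakGradientOn D u g)
    (hD : IsOpen D) (hγ : IsJohnCurve D σ K R x x₀ γ) (hR : 1 ≤ R) (hK : 1 ≤ K)
    (hσ : σ ∈ Icc 1 S) (J : ℕ) :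
    edist (johnAverage u γ S K σ R) (johnAverage u γ S K σ (R * (1 / 2) ^ J))
      ≤ (johnChainConst n S K R +
          poincareConst n * ENNReal.ofReal ((2 ^ S) ^ n * johnRadiusConst S K R (n - 1))) *
        dyadicPotential (volume.restrict D) (‖g ·‖ₑ) (2 * R ^ (S - 1) * R) (σ * (n - 1)) x := by
  have hstep := edist_le_range_sum_edist (fun j : ℕ => johnAverage u γ S K σ (R * (1 / 2) ^ j)) J
  rw [pow_zero, mul_one] at hstep
  rw [dyadicPotential, ← ENNReal.tsum_mul_left]
  refine hstep.trans ((Finset.sum_le_sum fun j _ => ?_).trans (ENNReal.sum_le_tsum _))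
  have hscale : R * (1 / 2 : ℝ) ^ j ∈ Ioc 0 R := ⟨by positivity,
    mul_le_of_le_one_right (by positivity) (pow_le_one₀ (by norm_num) (by norm_num))⟩
  rw [pow_succ, mul_assoc (2 * R ^ (S - 1)), ← mul_assoc R, mul_one_div (R * _)]
  exact h.edist_johnAverage_half_le hD hγ hR hK hσ hscale

theorem HasWeakGradientOn.edist_preciseRep_le_dyadicPotential (h : HasWeakGradientOn D u g)
    (hD : IsOpen D) (hx : x ∈ D) (hγ : IsJohnCurve D σ K R x x₀ γ) (hR : 1 ≤ R) (hK : 1 ≤ K)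
    (hσ : σ ∈ Icc 1 S)
    (hfin : dyadicPotential (volume.restrict D) (‖g ·‖ₑ) (2 * R ^ (S - 1) * R)
      (σ * (n - 1)) x ≠ ⊤) :
    edist (preciseRep u x) (johnAverage u γ S K σ R)
      ≤ (2 * johnChainConst n S K R +
          poincareConst n * ENNReal.ofReal ((2 ^ S) ^ n * johnRadiusConst S K R (n - 1))) *
        dyadicPotential (volume.restrict D) (‖g ·‖ₑ) (2 * R ^ (S - 1) * R) (σ * (n - 1)) x := by
  have : 0 < R := zero_lt_one.trans_le hR
  have hn : (0 : ℝ) ≤ n - 1 := sub_nonneg.2 (Nat.one_le_cast.2 NeZero.one_le)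
  set P := dyadicPotential (volume.restrict D) (‖g ·‖ₑ) (2 * R ^ (S - 1) * R) (σ * (n - 1)) x
  have hscale : Tendsto (fun j : ℕ => R * (1 / 2 : ℝ) ^ j) atTop (𝓝[>] 0) := by
    refine tendsto_nhdsWithin_iff.2 ⟨?_, Eventually.of_forall fun j => mem_Ioi.2 (by positivity)⟩
    simpa using (tendsto_pow_atTop_nhds_zero_of_lt_one (r := (1 / 2 : ℝ)) (by norm_num)
      (by norm_num)).const_mul R
  have hlim := h.tendsto_preciseRep_of_dyadicPotential_ne_top (hD.mem_nhds hx) (by positivity)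
    (le_mul_of_one_le_left hn hσ.1) hfin
  have hradius := (tendsto_johnRadius_nhdsGT_zero (S := S) (zero_lt_one.trans_le hK)
    (zero_lt_one.trans_le hσ.1)).comp hscale
  refine le_of_tendsto ((hlim.comp hradius).edist tendsto_const_nhds) ?_
  filter_upwards [hscale.eventually
    (h.eventually_edist_average_johnAverage_le hγ hR hK hσ (hD.mem_nhds hx))] with j hj
  rw [← mul_assoc (2 * R ^ (S - 1))] at hj
  have hdyadic := h.edist_johnAverage_dyadic_le hD hγ hR hK hσ j
  rw [edist_comm] at hdyadic
  refine (edist_triangle _ _ _).trans ((add_le_add (hj.trans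
    (mul_le_mul_right (scaledBallIntegral_le_dyadicPotential _ _ _ _ _ j) _)) hdyadic).trans_eq ?_)
  change _ * P + _ * P = _
  ring

end JohnCurve

theorem IsVarJohnDomain.exists_edist_preciseRep_le {n : ℕ} [NeZero n]
    {D : Set (EuclideanSpace ℝ (Fin n))} {s : EuclideanSpace ℝ (Fin n) → ℝ}
    {x₀ : EuclideanSpace ℝ (Fin n)} (hD : IsVarJohnDomain D s x₀) {S : ℝ}
    (hsS : ∀ x ∈ D, s x ≤ S) :
    ∃ r₀ : ℝ, 1 ≤ r₀ ∧ (∀ x ∈ D, D ⊆ ball x r₀) ∧ ∃ C : ℝ≥0∞, C ≠ ⊤ ∧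
      ∀ (u : EuclideanSpace ℝ (Fin n) → ℝ)
        (g : EuclideanSpace ℝ (Fin n) → EuclideanSpace ℝ (Fin n)),
        HasWeakGradientOn D u g → ∀ x ∈ D,
          edist (preciseRep u x) (⨍ y in ball x₀ (infDist x₀ (frontier D)), u y)
            ≤ C * dyadicPotential (volume.restrict D) (‖g ·‖ₑ) r₀ (s x * (n - 1)) x := by
  obtain ⟨R, K, hR, hK, hDR, hcurve⟩ := hD.exists_isJohnCurve hsS
  obtain ⟨a, b, hab⟩ := hD
  have hS : 1 ≤ S := (hab.one_le _ hab.center_mem).trans (hsS _ hab.center_mem)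
  have hb : 1 ≤ 2 * R ^ (S - 1) := one_le_mul_of_one_le_of_one_le one_le_two
    (Real.one_le_rpow hR (sub_nonneg.2 hS))
  have hRr₀ : R ≤ 2 * R ^ (S - 1) * R := le_mul_of_one_le_left (by positivity) hb
  have hpoincare := poincareConst_ne_top n
  have hchain := johnChainConst_ne_top n S K R
  set C₁ := 2 * johnChainConst n S K R +
    poincareConst n * ENNReal.ofReal ((2 ^ S) ^ n * johnRadiusConst S K R (n - 1))
  set d₀ := infDist x₀ (frontier D)
  set C₂ := poincareConst n * ENNReal.ofReal ((d₀ * (2 ^ (S + 1) * K)) ^ n *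
    (d₀ ^ (1 - (n : ℝ)) * (2 * R ^ (S - 1) * R) ^ (S * (n - 1))))
  refine ⟨2 * R ^ (S - 1) * R, hR.trans hRr₀,
    fun x hx => (hDR x hx).trans (ball_subset_ball hRr₀), C₁ + C₂ + 1, by finiteness,
    fun u g h x hx => ?_⟩
  obtain ⟨γ, hγ⟩ := hcurve x hx
  have hσ : s x ∈ Icc 1 S := ⟨hab.one_le x hx, hsS x hx⟩
  by_cases hfin : dyadicPotential (volume.restrict D) (‖g ·‖ₑ) (2 * R ^ (S - 1) * R)
      (s x * (n - 1)) x = ⊤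
  · rw [hfin, ENNReal.mul_top (by simp)]
    exact le_top
  refine (edist_triangle _ _ _).trans ((add_le_add
    (h.edist_preciseRep_le_dyadicPotential hab.isOpen hx hγ hR hK hσ hfin)
    ((h.edist_johnAverage_center_le hab.isOpen hγ hR hK hσ (hDR x hx) rfl).trans
      (mul_le_mul_right (scaledBallIntegral_self_le_dyadicPotential _ _ _ _ _) _))).trans ?_)
  rw [← add_mul]
  exact mul_le_mul_left le_self_add _

theorem mul_le_of_holderConjugate {f G t p p' q : ℝ} (hf : 0 ≤ f) (hG : 0 ≤ G) (ht : 1 ≤ t)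
    (hpp : p.HolderConjugate p') (hq : q ≤ p') :
    G * f ≤ t * f ^ p + t ^ (1 - q) * G ^ p' := by
  have ht0 : 0 < t := by linarith
  have hyoung : f * (G / t) ≤ f ^ p + (G / t) ^ p' :=
    (Real.young_inequality_of_nonneg hf (div_nonneg hG ht0.le) hpp).trans
      (add_le_add (div_le_self (by positivity) hpp.lt.le)
        (div_le_self (by positivity) hpp.symm.lt.le))
  have hpow : t / t ^ p' ≤ t ^ (1 - q) := by
    rw [← Real.rpow_one_sub' ht0.le (by linarith [hpp.symm.lt])]
    exact Real.rpow_le_rpow_of_exponent_le ht (by linarith)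
  calc G * f = t * (f * (G / t)) := by field_simp
    _ ≤ t * (f ^ p + (G / t) ^ p') := by gcongr
    _ = t * f ^ p + t / t ^ p' * G ^ p' := by rw [Real.div_rpow hG ht0.le]; ring
    _ ≤ t * f ^ p + t ^ (1 - q) * G ^ p' := by gcongr

theorem holderConjugate_div_sub_div {N b : ℝ} (hb : 0 < b) (hbN : b < N) :
    (N / (N - b)).HolderConjugate (N / b) := by
  have hN : 0 < N := hb.trans hbN
  rw [Real.holderConjugate_iff, one_lt_div (by linarith), inv_div, inv_div, ← add_div]
  exact ⟨by linarith, by rw [sub_add_cancel, div_self hN.ne']⟩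

theorem ofReal_mul_lintegral_enorm_le {E : Type*} [MeasurableSpace E] {μ : Measure E}
    {f p p' : E → ℝ} {G t q Q : ℝ} (hG : 0 ≤ G) (ht : 1 ≤ t)
    (hpp : ∀ᵐ y ∂μ, (p y).HolderConjugate (p' y)) (hq : ∀ᵐ y ∂μ, q ≤ p' y)
    (hQ : ∀ᵐ y ∂μ, G ^ p' y ≤ Q) :
    ENNReal.ofReal G * ∫⁻ y, ‖f y‖ₑ ∂μ
      ≤ ENNReal.ofReal t * ∫⁻ y, ENNReal.ofReal (|f y| ^ p y) ∂μ
        + ENNReal.ofReal (t ^ (1 - q)) * (ENNReal.ofReal Q * μ univ) := by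
  have hpointwise : ∀ᵐ y ∂μ, ENNReal.ofReal G * ‖f y‖ₑ
      ≤ ENNReal.ofReal t * ENNReal.ofReal (|f y| ^ p y)
        + ENNReal.ofReal (t ^ (1 - q)) * ENNReal.ofReal Q := by
    filter_upwards [hpp, hq, hQ] with y hpp hq hQ
    have hQ0 : 0 ≤ Q := (Real.rpow_nonneg hG _).trans hQ
    rw [← ofReal_norm, Real.norm_eq_abs, ← ENNReal.ofReal_mul hG,
      ← ENNReal.ofReal_mul (by linarith), ← ENNReal.ofReal_mul (by positivity),
      ← ENNReal.ofReal_add (by positivity) (by positivity)]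
    refine ENNReal.ofReal_le_ofReal
      ((mul_le_of_holderConjugate (abs_nonneg _) hG ht hpp hq).trans ?_)
    gcongr
  rw [← lintegral_const_mul' _ _ ENNReal.ofReal_ne_top]
  refine (lintegral_mono_ae hpointwise).trans_eq ?_
  rw [lintegral_add_right _ measurable_const, lintegral_const,
    lintegral_const_mul' _ _ ENNReal.ofReal_ne_top, mul_assoc]

theorem log_exp_one_add_one_div_pos {r : ℝ} (hr : 0 < r) : 0 < Real.log (Real.exp 1 + 1 / r) :=
  Real.log_pos (by linarith [Real.add_one_lt_exp one_ne_zero, one_div_pos.2 hr])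

theorem rpow_neg_div_log_le {r c : ℝ} (hr : 0 < r) (hc : 0 ≤ c) :
    r ^ (-(c / Real.log (Real.exp 1 + 1 / r))) ≤ Real.exp c := by
  have hlog : -Real.log r ≤ Real.log (Real.exp 1 + 1 / r) := by
    rw [← Real.log_inv, ← one_div]
    exact Real.log_le_log (one_div_pos.2 hr) (by linarith [Real.exp_pos 1])
  rw [Real.rpow_def_of_pos hr, mul_neg, ← neg_mul]
  refine Real.exp_le_exp.2 ?_
  rw [mul_div_assoc', div_le_iff₀ (log_exp_one_add_one_div_pos hr), mul_comm]
  gcongr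

theorem rpow_neg_rpow_div_le_of_lt_one {N r c a b : ℝ} (hN : 0 ≤ N) (hr : 0 < r) (hr1 : r < 1)
    (hc : 0 ≤ c) (hb : 1 ≤ b) (hab : a - b ≤ c / Real.log (Real.exp 1 + 1 / r)) :
    (r ^ (-a)) ^ (N / b) ≤ Real.exp (N * c) * r ^ (-N) := by
  have hratio : a / b - 1 ≤ c / Real.log (Real.exp 1 + 1 / r) := by
    have hb0 : 0 < b := by linarith
    have hnonneg := div_nonneg hc (log_exp_one_add_one_div_pos hr).le
    rw [div_sub_one hb0.ne', div_le_iff₀ hb0]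
    exact hab.trans (le_mul_of_one_le_right hnonneg hb)
  calc (r ^ (-a)) ^ (N / b) = r ^ (-(N * (a / b - 1))) * r ^ (-N) := by
        rw [← Real.rpow_mul hr.le, ← Real.rpow_add hr]
        ring_nf
    _ ≤ r ^ (-(N * (c / Real.log (Real.exp 1 + 1 / r)))) * r ^ (-N) := by
        refine mul_le_mul_of_nonneg_right ?_ (by positivity)
        exact Real.rpow_le_rpow_of_exponent_ge hr hr1.le
          (neg_le_neg (mul_le_mul_of_nonneg_left hratio hN))
    _ ≤ Real.exp (N * c) * r ^ (-N) := by
        rw [mul_div_assoc']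
        gcongr
        exact rpow_neg_div_log_le hr (by positivity)

theorem rpow_neg_rpow_div_le_of_one_le {N r r₀ a b : ℝ} (hN : 0 ≤ N) (hr : 1 ≤ r) (hrr : r ≤ r₀)
    (ha : 0 ≤ a) (hb : 0 ≤ b) : (r ^ (-a)) ^ (N / b) ≤ r₀ ^ N * r ^ (-N) := by
  have hr0 : 0 < r := by linarith
  calc (r ^ (-a)) ^ (N / b) ≤ 1 :=
        Real.rpow_le_one (by positivity)
          (Real.rpow_le_one_of_one_le_of_nonpos hr (neg_nonpos.2 ha)) (by positivity)
    _ = r ^ N * r ^ (-N) := by rw [← Real.rpow_add hr0, add_neg_cancel, Real.rpow_zero]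
    _ ≤ r₀ ^ N * r ^ (-N) := by gcongr

/-- Log-Hölder continuity is exactly what allows one to replace the exponent `β y` by `β x` in
powers of scales `r > dist x y`. -/
theorem IsLogHolderOn.exists_rpow_neg_rpow_div_le {E : Type*} [MetricSpace E] {β : E → ℝ}
    {D : Set E} (h : IsLogHolderOn β D) (hβ : ∀ x ∈ D, 1 ≤ β x) {N r₀ : ℝ} (hN : 0 ≤ N)
    (hr₀ : 0 ≤ r₀) :
    ∃ K : ℝ, 0 ≤ K ∧ ∀ x ∈ D, ∀ y ∈ D, ∀ r, dist x y < r → r ≤ r₀ →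
      (r ^ (-β x)) ^ (N / β y) ≤ K * r ^ (-N) := by
  obtain ⟨c, hc, hβc⟩ := h
  refine ⟨Real.exp (N * c) + r₀ ^ N, by positivity, fun x hx y hy r hxy hrr => ?_⟩
  have hr : 0 < r := dist_nonneg.trans_lt hxy
  have hβx := hβ x hx
  have hβy := hβ y hy
  rw [add_mul]
  rcases lt_or_ge r 1 with hr1 | hr1
  · refine (rpow_neg_rpow_div_le_of_lt_one hN hr hr1 hc.le hβy ?_).trans
      (le_add_of_nonneg_right (by positivity))
    rcases eq_or_ne x y with rfl | hne
    · rw [sub_self]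
      exact div_nonneg hc.le (log_exp_one_add_one_div_pos hr).le
    have hd : 0 < dist x y := dist_pos.2 hne
    refine (le_abs_self _).trans ((hβc x hx y hy hne).trans ?_)
    have := log_exp_one_add_one_div_pos hr
    gcongr
  · exact (rpow_neg_rpow_div_le_of_one_le hN hr1 hrr (by linarith) (by linarith)).trans
      (le_add_of_nonneg_left (by positivity))

/-- The dyadic annulus `r₀ 2 ^ (-(i + 1)) ≤ dist y x < r₀ 2 ^ (-i)` about `x`. -/
def dyadicAnnulus {E : Type*} [PseudoMetricSpace E] (r₀ : ℝ) (x : E) (i : ℕ) : Set E :=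
  ball x (r₀ * (1 / 2) ^ i) \ ball x (r₀ * (1 / 2) ^ (i + 1))

theorem measurableSet_dyadicAnnulus {E : Type*} [PseudoMetricSpace E] [MeasurableSpace E]
    [OpensMeasurableSpace E] (r₀ : ℝ) (x : E) (i : ℕ) : MeasurableSet (dyadicAnnulus r₀ x i) :=
  measurableSet_ball.diff measurableSet_ball

theorem dyadicAnnulus_subset_ball {E : Type*} [PseudoMetricSpace E] (r₀ : ℝ) (x : E) (i : ℕ) :
    dyadicAnnulus r₀ x i ⊆ ball x (r₀ * (1 / 2) ^ i) :=
  sdiff_subset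

theorem pairwise_disjoint_dyadicAnnulus {E : Type*} [PseudoMetricSpace E] {r₀ : ℝ}
    (hr₀ : 0 ≤ r₀) (x : E) : Pairwise (Function.onFun Disjoint (dyadicAnnulus r₀ x)) := by
  refine (pairwise_disjoint_on _).2 fun i j hij => Set.disjoint_left.2 ?_
  rintro y ⟨-, hy⟩ ⟨hy', -⟩
  refine hy (ball_subset_ball (mul_le_mul_of_nonneg_left ?_ hr₀) hy')
  exact pow_le_pow_of_le_one (by norm_num) (by norm_num) hij

theorem ball_subset_singleton_union_iUnion_dyadicAnnulus {E : Type*} [MetricSpace E] (r₀ : ℝ)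
    (x : E) (j : ℕ) :
    ball x (r₀ * (1 / 2) ^ j) ⊆ {x} ∪ ⋃ k, dyadicAnnulus r₀ x (j + k) := by
  intro y hy
  by_contra hcon
  simp only [mem_union, mem_singleton_iff, mem_iUnion, not_or, not_exists] at hcon
  have hball : ∀ k, y ∈ ball x (r₀ * (1 / 2) ^ (j + k)) := by
    intro k
    induction k with
    | zero => exact hy
    | succ k ih => exact by_contra fun hk => hcon.2 k ⟨ih, hk⟩
  have hlim : Tendsto (fun k : ℕ => r₀ * (1 / 2 : ℝ) ^ (j + k)) atTop (𝓝 0) := by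
    simpa only [pow_add, mul_assoc, mul_zero] using ((tendsto_pow_atTop_nhds_zero_of_lt_one
      (r := (1 / 2 : ℝ)) (by norm_num) (by norm_num)).const_mul ((1 / 2) ^ j)).const_mul r₀
  exact hcon.1 (dist_le_zero.1 (ge_of_tendsto' hlim fun k => (mem_ball.1 (hball k)).le))

theorem rpow_neg_le_half_pow_mul {r β : ℝ} (hr : 0 ≤ r) (hβ : 1 ≤ β) (k : ℕ) :
    r ^ (-β) ≤ (1 / 2) ^ k * (r * (1 / 2) ^ k) ^ (-β) := by
  have hk : (0 : ℝ) < (1 / 2) ^ k := by positivity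
  have hpow : (1 / 2 : ℝ) ^ k * ((1 / 2) ^ k) ^ (-β) = ((1 / 2) ^ k) ^ (1 - β) := by
    rw [sub_eq_add_neg, Real.rpow_add hk, Real.rpow_one]
  rw [Real.mul_rpow hr hk.le, mul_left_comm, hpow]
  refine le_mul_of_one_le_right (by positivity) ?_
  exact Real.one_le_rpow_of_pos_of_le_one_of_nonpos hk
    (pow_le_one₀ (by norm_num) (by norm_num)) (by linarith)

theorem ofReal_half_pow (k : ℕ) : ENNReal.ofReal ((1 / 2) ^ k) = (1 / 2) ^ k := by
  rw [ENNReal.ofReal_pow (by norm_num), ENNReal.ofReal_div_of_pos two_pos, ENNReal.ofReal_one,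
    ENNReal.ofReal_ofNat]

theorem scaledBallIntegral_le_tsum_dyadicAnnulus {E : Type*} [MetricSpace E] [MeasurableSpace E]
    {μ : Measure E} [NullSingletonClass μ] {r₀ β : ℝ} (hr₀ : 0 ≤ r₀) (hβ : 1 ≤ β)
    (f : E → ℝ≥0∞) (x : E) (j : ℕ) :
    scaledBallIntegral μ f β x (r₀ * (1 / 2) ^ j) ≤ ∑' k : ℕ, (1 / 2) ^ k *
      (ENNReal.ofReal ((r₀ * (1 / 2) ^ (j + k)) ^ (-β)) *
        ∫⁻ y in dyadicAnnulus r₀ x (j + k), f y ∂μ) := by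
  have hball : ∫⁻ y in ball x (r₀ * (1 / 2) ^ j), f y ∂μ
      ≤ ∑' k, ∫⁻ y in dyadicAnnulus r₀ x (j + k), f y ∂μ := by
    refine (lintegral_mono_set
      (ball_subset_singleton_union_iUnion_dyadicAnnulus r₀ x j)).trans ?_
    refine (lintegral_union_le _ _ _).trans ?_
    rw [setLIntegral_measure_zero _ _ (measure_singleton x), zero_add]
    exact lintegral_iUnion_le _ _
  refine (mul_le_mul' le_rfl hball).trans ?_
  rw [← ENNReal.tsum_mul_left]
  refine ENNReal.tsum_le_tsum fun k => ?_
  rw [← mul_assoc, ← ofReal_half_pow, ← ENNReal.ofReal_mul (by positivity), pow_add, ← mul_assoc]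
  exact mul_le_mul' (ENNReal.ofReal_le_ofReal
    (rpow_neg_le_half_pow_mul (by positivity) hβ k)) le_rfl

theorem dyadicPotential_le_tsum_dyadicAnnulus {E : Type*} [MetricSpace E] [MeasurableSpace E]
    {μ : Measure E} [NullSingletonClass μ] {r₀ β : ℝ} (hr₀ : 0 ≤ r₀) (hβ : 1 ≤ β)
    (f : E → ℝ≥0∞) (x : E) :
    dyadicPotential μ f r₀ β x ≤ 2 * ∑' i : ℕ,
      ENNReal.ofReal ((r₀ * (1 / 2) ^ i) ^ (-β)) * ∫⁻ y in dyadicAnnulus r₀ x i, f y ∂μ := by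
  set F : ℕ → ℝ≥0∞ := fun i =>
    ENNReal.ofReal ((r₀ * (1 / 2) ^ i) ^ (-β)) * ∫⁻ y in dyadicAnnulus r₀ x i, f y ∂μ
  calc dyadicPotential μ f r₀ β x
      ≤ ∑' j : ℕ, ∑' k : ℕ, (1 / 2) ^ k * F (j + k) :=
        ENNReal.tsum_le_tsum fun j => scaledBallIntegral_le_tsum_dyadicAnnulus hr₀ hβ f x j
    _ = ∑' k : ℕ, (1 / 2) ^ k * ∑' j : ℕ, F (j + k) := by
        rw [ENNReal.tsum_comm]
        exact tsum_congr fun k => ENNReal.tsum_mul_left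
    _ ≤ ∑' k : ℕ, (1 / 2) ^ k * ∑' i : ℕ, F i :=
        ENNReal.tsum_le_tsum fun k => mul_le_mul' le_rfl
          (ENNReal.tsum_comp_le_tsum_of_injective (add_left_injective k) F)
    _ = 2 * ∑' i : ℕ, F i := by
        rw [ENNReal.tsum_mul_right, ENNReal.tsum_geometric, one_div, ENNReal.one_sub_inv_two,
          inv_inv]

theorem sum_range_le_ofReal_rpow_mul {q : ℝ} (hq : 0 < q) {W C : ℝ≥0∞} {F w : ℕ → ℝ≥0∞} {M : ℕ}
    (hM : 1 ≤ M) (hw : ∑' i, w i ≤ W)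
    (hF : ∀ i, ∀ t : ℝ, 1 ≤ t →
      F i ≤ ENNReal.ofReal t * w i + ENNReal.ofReal (t ^ (1 - q)) * C) :
    ∑ i ∈ Finset.range M, F i ≤ (W + C) * ENNReal.ofReal ((M : ℝ) ^ q⁻¹) := by
  set L : ℝ := (M : ℝ) ^ q⁻¹
  have hM0 : (0 : ℝ) < M := by exact_mod_cast hM
  have hL : 1 ≤ L := Real.one_le_rpow (by exact_mod_cast hM) (by positivity)
  have hML : (M : ℝ≥0∞) * ENNReal.ofReal (L ^ (1 - q)) = ENNReal.ofReal L := by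
    rw [← ENNReal.ofReal_natCast, ← ENNReal.ofReal_mul hM0.le, ← Real.rpow_mul hM0.le, mul_sub,
      inv_mul_cancel₀ hq.ne', mul_one, Real.rpow_sub_one hM0.ne', mul_div_cancel₀ _ hM0.ne']
  calc ∑ i ∈ Finset.range M, F i
      ≤ ∑ i ∈ Finset.range M, (ENNReal.ofReal L * w i + ENNReal.ofReal (L ^ (1 - q)) * C) :=
        Finset.sum_le_sum fun i _ => hF i L hL
    _ = ENNReal.ofReal L * (∑ i ∈ Finset.range M, w i)
        + (M : ℝ≥0∞) * ENNReal.ofReal (L ^ (1 - q)) * C := by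
        rw [Finset.sum_add_distrib, Finset.mul_sum, Finset.sum_const, Finset.card_range,
          nsmul_eq_mul, mul_assoc]
    _ ≤ ENNReal.ofReal L * W + ENNReal.ofReal L * C := by
        rw [hML]
        gcongr
        exact (ENNReal.sum_le_tsum _).trans hw
    _ = (W + C) * ENNReal.ofReal L := by ring

theorem tsum_pow_ne_top_of_lt_one {θ : ℝ≥0∞} (hθ : θ < 1) : ∑' k : ℕ, θ ^ k ≠ ⊤ := by
  rw [ENNReal.tsum_geometric, ENNReal.inv_ne_top]
  exact (tsub_pos_of_lt hθ).ne'

theorem exists_tsum_le_of_le_half_pow {q : ℝ} (hq : 1 < q) {C : ℝ≥0∞} (hC : C ≠ ⊤) :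
    ∃ K : ℝ≥0∞, K ≠ ⊤ ∧ ∀ F w : ℕ → ℝ≥0∞, (∀ k, w k ≤ (1 / 2) ^ k) →
      (∀ k, ∀ t : ℝ, 1 ≤ t → F k ≤ ENNReal.ofReal t * w k + ENNReal.ofReal (t ^ (1 - q)) * C) →
      ∑' k, F k ≤ K := by
  set b : ℝ := 3 / 2
  set θ₁ : ℝ≥0∞ := ENNReal.ofReal b * (1 / 2)
  set θ₂ : ℝ≥0∞ := ENNReal.ofReal (b ^ (1 - q))
  have hθ₁ : θ₁ < 1 := by
    have hhalf : ENNReal.ofReal (1 / 2) = 1 / 2 := by simpa only [pow_one] using ofReal_half_pow 1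
    simp only [θ₁]
    rw [← hhalf, ← ENNReal.ofReal_mul (by positivity), ENNReal.ofReal_lt_one]
    norm_num [b]
  have hθ₂ : θ₂ < 1 :=
    ENNReal.ofReal_lt_one.2 (Real.rpow_lt_one_of_one_lt_of_neg (by norm_num [b]) (by linarith))
  have h₁ := tsum_pow_ne_top_of_lt_one hθ₁
  have h₂ := tsum_pow_ne_top_of_lt_one hθ₂
  refine ⟨∑' k, θ₁ ^ k + (∑' k, θ₂ ^ k) * C, by finiteness, fun F w hw hF => ?_⟩
  rw [← ENNReal.tsum_mul_right, ← ENNReal.tsum_add]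
  refine ENNReal.tsum_le_tsum fun k => ?_
  refine (hF k (b ^ k) (one_le_pow₀ (by norm_num [b]))).trans (add_le_add ?_ (le_of_eq ?_))
  · rw [mul_pow, ENNReal.ofReal_pow (by positivity)]
    exact mul_le_mul' le_rfl (hw k)
  · rw [← ENNReal.ofReal_pow (by positivity), ← Real.rpow_natCast, ← Real.rpow_natCast,
      ← Real.rpow_mul (by positivity), ← Real.rpow_mul (by positivity), mul_comm (k : ℝ)]

/-- The first `M` terms are balanced at the optimal parameter `t = M ^ (1 / q)`; after that the
weights decay geometrically and the parameters `t = b ^ k` with `1 < b < 2` make both parts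
summable. -/
theorem exists_tsum_le_mul_rpow {q : ℝ} (hq : 1 < q) {W C : ℝ≥0∞} (hW : W ≠ ⊤) (hC : C ≠ ⊤) :
    ∃ K : ℝ≥0∞, K ≠ ⊤ ∧ ∀ (F w : ℕ → ℝ≥0∞) (M : ℕ), 1 ≤ M → ∑' i, w i ≤ W →
      (∀ k, w (M + k) ≤ (1 / 2) ^ k) →
      (∀ i, ∀ t : ℝ, 1 ≤ t → F i ≤ ENNReal.ofReal t * w i + ENNReal.ofReal (t ^ (1 - q)) * C) →
      ∑' i, F i ≤ K * ENNReal.ofReal ((M : ℝ) ^ q⁻¹) := by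
  obtain ⟨K, hK, htail⟩ := exists_tsum_le_of_le_half_pow hq hC
  refine ⟨W + C + K, by finiteness, fun F w M hM hw hsmall hF => ?_⟩
  have hone : 1 ≤ ENNReal.ofReal ((M : ℝ) ^ q⁻¹) :=
    ENNReal.one_le_ofReal.2 (Real.one_le_rpow (by exact_mod_cast hM) (by positivity))
  rw [← Summable.sum_add_tsum_nat_add' (f := F) (k := M) ENNReal.summable, add_mul]
  refine add_le_add (sum_range_le_ofReal_rpow_mul (by linarith) hM hw hF) ?_
  refine (htail (fun k => F (k + M)) (fun k => w (k + M)) (fun k => ?_) fun k => hF _).trans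
    (le_mul_of_one_le_right' hone)
  rw [add_comm k]
  exact hsmall k

/-- The measure `A ↦ ∫_{A ∩ D} |f| ^ p(·)`, whose total mass is the modular of `f` on `D`. -/
def modularMeasure {E : Type*} [MeasureSpace E] (D : Set E) (p f : E → ℝ) : Measure E :=
  (volume.restrict D).withDensity fun y => ENNReal.ofReal (|f y| ^ p y)

theorem modularMeasure_univ {E : Type*} [MeasureSpace E] (D : Set E) (p f : E → ℝ) :
    modularMeasure D p f univ = varModular D p f := by
  rw [modularMeasure, withDensity_apply _ MeasurableSet.univ, Measure.restrict_univ, varModular]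

theorem ofReal_rpow_mul_lintegral_enorm_le {E : Type*} [MetricSpace E] [MeasureSpace E]
    {D : Set E} (hD : MeasurableSet D) {β f : E → ℝ} {B N K r t : ℝ} {κ : ℝ≥0∞} {x : E}
    {A : Set E} (hβ : ∀ y ∈ D, 0 < β y) (hB : ∀ y ∈ D, β y ≤ B) (hBN : B < N)
    (hvol : volume (ball x r) ≤ κ * ENNReal.ofReal (r ^ N)) (hr : 0 < r) (ht : 1 ≤ t) (hK : 0 ≤ K)
    (hβK : ∀ y ∈ D, dist x y < r → (r ^ (-β x)) ^ (N / β y) ≤ K * r ^ (-N))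
    (hA : MeasurableSet A) (hAr : A ⊆ ball x r) :
    ENNReal.ofReal (r ^ (-β x)) * ∫⁻ y in A, ‖f y‖ₑ ∂(volume.restrict D)
      ≤ ENNReal.ofReal t * modularMeasure D (fun y => N / (N - β y)) f A
        + ENNReal.ofReal (t ^ (1 - N / B)) * (κ * ENNReal.ofReal K) := by
  have hmem : ∀ᵐ y ∂((volume.restrict D).restrict A), y ∈ A ∧ y ∈ D := by
    filter_upwards [ae_restrict_mem hA, ae_restrict_of_ae (ae_restrict_mem hD)] with y hyA hyD
    exact ⟨hyA, hyD⟩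
  rw [modularMeasure, withDensity_apply _ hA]
  refine (ofReal_mul_lintegral_enorm_le (q := N / B) (Q := K * r ^ (-N)) (by positivity) ht
    (hmem.mono fun y hy => holderConjugate_div_sub_div (hβ y hy.2) ((hB y hy.2).trans_lt hBN))
    (hmem.mono fun y hy => ?_)
    (hmem.mono fun y hy => hβK y hy.2 (mem_ball'.1 (hAr hy.1)))).trans
    (add_le_add le_rfl (mul_le_mul' le_rfl ?_))
  · have := hβ y hy.2
    have := hB y hy.2
    exact div_le_div_of_nonneg_left (by linarith) (by linarith) this
  calc ENNReal.ofReal (K * r ^ (-N)) * (volume.restrict D).restrict A univ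
      ≤ ENNReal.ofReal (K * r ^ (-N)) * (κ * ENNReal.ofReal (r ^ N)) := by
        rw [Measure.restrict_apply_univ]
        exact mul_le_mul' le_rfl
          ((Measure.restrict_apply_le _ _).trans ((measure_mono hAr).trans hvol))
    _ = κ * ENNReal.ofReal K := by
        rw [mul_left_comm, ← ENNReal.ofReal_mul (by positivity), mul_assoc, ← Real.rpow_add hr,
          neg_add_cancel, Real.rpow_zero, mul_one]

theorem IsLogHolderOn.exists_dyadicPotential_le {E : Type*} [MetricSpace E] [MeasureSpace E]
    [OpensMeasurableSpace E] [NullSingletonClass (volume : Measure E)] {D : Set E}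
    (hD : MeasurableSet D) {β : E → ℝ} (hβ : IsLogHolderOn β D) {B N r₀ : ℝ} {κ W : ℝ≥0∞}
    (h1 : ∀ y ∈ D, 1 ≤ β y) (hB : ∀ y ∈ D, β y ≤ B) (hBN : B < N) (hκ : κ ≠ ⊤)
    (hvol : ∀ (x : E) (r : ℝ), 0 < r → volume (ball x r) ≤ κ * ENNReal.ofReal (r ^ N))
    (hr₀ : 0 < r₀) (hW : W ≠ ⊤) :
    ∃ C : ℝ≥0∞, C ≠ ⊤ ∧ ∀ (f : E → ℝ) (x : E) (M : ℕ),
      varModular D (fun y => N / (N - β y)) f ≤ W → x ∈ D → 1 ≤ M →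
      (∀ k : ℕ, modularMeasure D (fun y => N / (N - β y)) f (ball x (r₀ * (1 / 2) ^ (M + k)))
        ≤ (1 / 2) ^ k) →
      dyadicPotential (volume.restrict D) (‖f ·‖ₑ) r₀ (β x) x
        ≤ C * ENNReal.ofReal ((M : ℝ) ^ (B / N)) := by
  rcases D.eq_empty_or_nonempty with rfl | ⟨z, hz⟩
  · exact ⟨0, ENNReal.zero_ne_top, fun _ _ _ _ hx => absurd hx (notMem_empty _)⟩
  have hB0 : 0 < B := by linarith [h1 z hz, hB z hz]
  obtain ⟨K, hK, hβK⟩ := hβ.exists_rpow_neg_rpow_div_le h1 (N := N) (by linarith) hr₀.le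
  obtain ⟨C, hC, hsum⟩ := exists_tsum_le_mul_rpow ((one_lt_div hB0).2 hBN) hW
    (C := κ * ENNReal.ofReal K) (ENNReal.mul_ne_top hκ ENNReal.ofReal_ne_top)
  refine ⟨2 * C, by finiteness, fun f x M hfW hx hM hsmall => ?_⟩
  set ν := modularMeasure D (fun y => N / (N - β y)) f
  have hmass : ∑' i, ν (dyadicAnnulus r₀ x i) ≤ W := by
    rw [← measure_iUnion (pairwise_disjoint_dyadicAnnulus hr₀.le x)
      (measurableSet_dyadicAnnulus r₀ x)]
    exact (measure_mono (subset_univ _)).trans ((modularMeasure_univ D _ f).trans_le hfW)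
  refine (dyadicPotential_le_tsum_dyadicAnnulus hr₀.le (h1 x hx) _ x).trans ?_
  rw [← inv_div N B, mul_assoc]
  refine mul_le_mul' le_rfl (hsum _ _ M hM hmass
    (fun k => (measure_mono (dyadicAnnulus_subset_ball r₀ x _)).trans (hsmall k))
    fun i t ht => ?_)
  have hr : 0 < r₀ * (1 / 2 : ℝ) ^ i := by positivity
  have hrr : r₀ * (1 / 2 : ℝ) ^ i ≤ r₀ :=
    mul_le_of_le_one_right hr₀.le (pow_le_one₀ (by norm_num) (by norm_num))
  exact ofReal_rpow_mul_lintegral_enorm_le hD (fun y hy => by linarith [h1 y hy]) hB hBN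
    (hvol x _ hr) hr ht hK (fun y hy hxy => hβK x hx y hy _ hxy hrr)
    (measurableSet_dyadicAnnulus r₀ x i) (dyadicAnnulus_subset_ball r₀ x i)

theorem monotone_varHausdorffContent {E : Type*} [MetricSpace E] (U : Set E) (β : E → ℝ) :
    Monotone (varHausdorffContent U β) := fun _ _ h =>
  iInf₂_mono fun _ _ => iInf₂_mono fun _ _ => iInf_mono' fun hA => ⟨h.trans hA, le_rfl⟩

theorem varHausdorffContent_le_tsum {E ι : Type*} [MetricSpace E] [Countable ι] {U A : Set E}
    {β : E → ℝ} {x₀ : E} (hx₀ : x₀ ∈ U) (hβ : β x₀ ≠ 0) {x : ι → E} {r : ι → ℝ}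
    (hx : ∀ i, x i ∈ U) (hr : ∀ i, 0 ≤ r i) (hA : A ⊆ ⋃ i, ball (x i) (r i)) :
    varHausdorffContent U β A ≤ ∑' i, ENNReal.ofReal (r i ^ β (x i)) := by
  obtain ⟨e, he⟩ := exists_injective_nat ι
  set x' : ℕ → E := Function.extend e x fun _ => x₀
  set r' : ℕ → ℝ := Function.extend e r fun _ => 0
  have hx' : ∀ i, x' (e i) = x i := he.extend_apply _ _
  have hr' : ∀ i, r' (e i) = r i := he.extend_apply _ _
  have hpad : ∀ k ∉ range e, x' k = x₀ ∧ r' k = 0 := fun k hk =>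
    ⟨Function.extend_apply' _ _ _ hk, Function.extend_apply' _ _ _ hk⟩
  have hx'U : ∀ k, x' k ∈ U := fun k => by
    by_cases hk : k ∈ range e
    · obtain ⟨i, rfl⟩ := hk
      exact hx' i ▸ hx i
    · exact (hpad k hk).1 ▸ hx₀
  have hr'0 : ∀ k, 0 ≤ r' k := fun k => by
    by_cases hk : k ∈ range e
    · obtain ⟨i, rfl⟩ := hk
      exact (hr i).trans_eq (hr' i).symm
    · exact (hpad k hk).2.ge
  have hcover : A ⊆ ⋃ k, ball (x' k) (r' k) := hA.trans (iUnion_subset fun i =>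
    subset_iUnion_of_subset (e i) (by rw [hx', hr']))
  have hsum : ∑' k, ENNReal.ofReal (r' k ^ β (x' k)) = ∑' i, ENNReal.ofReal (r i ^ β (x i)) := by
    rw [← he.tsum_eq (Function.support_subset_iff'.2 fun k hk => ?_)]
    · simp only [hx', hr']
    · rw [(hpad k hk).1, (hpad k hk).2, Real.zero_rpow hβ, ENNReal.ofReal_zero]
  exact (iInf₂_le_of_le x' r' (iInf₂_le_of_le hx'U hr'0 (iInf_le _ hcover))).trans_eq hsum

theorem varHausdorffContent_le_of_subset_ball {E : Type*} [MetricSpace E] {U A : Set E}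
    {β : E → ℝ} {x : E} {r : ℝ} (hx : x ∈ U) (hβ : β x ≠ 0) (hr : 0 ≤ r) (hA : A ⊆ ball x r) :
    varHausdorffContent U β A ≤ ENNReal.ofReal (r ^ β x) := by
  refine (varHausdorffContent_le_tsum (ι := Unit) hx hβ (x := fun _ => x) (r := fun _ => r)
    (fun _ => hx) (fun _ => hr) (subset_iUnion_of_subset () hA)).trans_eq ?_
  exact tsum_fintype _ |>.trans (by simp)

theorem exists_countable_disjoint_ball_cover {E : Type*} [PseudoMetricSpace E]
    [TopologicalSpace.SeparableSpace E] {T : Set E} {r : E → ℝ} {R : ℝ} (hr : ∀ x ∈ T, 0 < r x)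
    (hR : ∀ x ∈ T, r x ≤ R) :
    ∃ v ⊆ T, v.Countable ∧ v.PairwiseDisjoint (fun x => ball x (r x)) ∧
      T ⊆ ⋃ x : v, ball (x : E) (5 * r x) := by
  obtain ⟨v, hvT, hdisj, hcover⟩ :=
    Vitali.exists_disjoint_subfamily_covering_enlargement_closedBall T id r R hR 4 (by norm_num)
  have hdisj' : v.PairwiseDisjoint (fun x => ball x (r x)) :=
    hdisj.mono fun x => ball_subset_closedBall
  refine ⟨v, hvT, hdisj'.countable_of_isOpen (fun x _ => isOpen_ball)
    (fun x hx => nonempty_ball.2 (hr x (hvT hx))), hdisj', fun x hx => ?_⟩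
  obtain ⟨b, hb, hsub⟩ := hcover x hx
  refine mem_iUnion.2 ⟨⟨b, hb⟩, ?_⟩
  have hxb : dist x b ≤ 4 * r b := mem_closedBall.1 (hsub (mem_closedBall_self (hr x hx).le))
  exact mem_ball.2 (by linarith [hr b (hvT hb)])

theorem varHausdorffContent_le_mul_measure_univ {E : Type*} [MetricSpace E]
    [TopologicalSpace.SeparableSpace E] [MeasurableSpace E] [OpensMeasurableSpace E]
    {U T : Set E} (hU : U.Nonempty) (hTU : T ⊆ U) {β : E → ℝ} (hβ : ∀ x ∈ U, β x ≠ 0)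
    {ν : Measure E} {K : ℝ≥0∞} {R : ℝ}
    (hT : ∀ x ∈ T, ∃ r, 0 < r ∧ r ≤ R ∧ ENNReal.ofReal ((5 * r) ^ β x) ≤ K * ν (ball x r)) :
    varHausdorffContent U β T ≤ K * ν univ := by
  choose! r hr hrR hmass using hT
  obtain ⟨v, hvT, hv, hdisj, hcover⟩ := exists_countable_disjoint_ball_cover hr hrR
  obtain ⟨z, hz⟩ := hU
  have := hv.to_subtype
  calc varHausdorffContent U β T
      ≤ ∑' x : v, ENNReal.ofReal ((5 * r x) ^ β x) :=
        varHausdorffContent_le_tsum hz (hβ z hz) (fun x => hTU (hvT x.2))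
          (fun x => by linarith [hr x (hvT x.2)]) hcover
    _ ≤ ∑' x : v, K * ν (ball (x : E) (r x)) :=
        ENNReal.tsum_le_tsum fun x => hmass x (hvT x.2)
    _ = K * ν (⋃ x : v, ball (x : E) (r x)) := by
        rw [ENNReal.tsum_mul_left, measure_iUnion
          ((pairwise_subtype_iff_pairwise_set v _).2 hdisj) fun _ => measurableSet_ball]
    _ ≤ K * ν univ := mul_le_mul' le_rfl (measure_mono (subset_univ _))

theorem mul_rpow_le_rpow_mul {R ρ b B : ℝ} (hR : 1 ≤ R) (hρ : 0 ≤ ρ) (hρ1 : ρ ≤ 1) (hb : 1 ≤ b)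
    (hbB : b ≤ B) : (R * ρ) ^ b ≤ R ^ B * ρ := by
  rw [Real.mul_rpow (by linarith) hρ]
  exact mul_le_mul (Real.rpow_le_rpow_of_exponent_le hR hbB)
    (Real.rpow_le_self_of_le_one hρ hρ1 hb) (by positivity) (by positivity)

theorem varHausdorffContent_concentration_le {E : Type*} [MetricSpace E]
    [TopologicalSpace.SeparableSpace E] [MeasurableSpace E] [OpensMeasurableSpace E]
    {U : Set E} (hU : U.Nonempty) {β : E → ℝ} {B r₀ : ℝ} (hβ : ∀ x ∈ U, 1 ≤ β x)
    (hB : ∀ x ∈ U, β x ≤ B) (hr₀ : 1 ≤ r₀) (ν : Measure E) (M : ℕ) :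
    varHausdorffContent U β
        {x ∈ U | ∃ k : ℕ, (1 / 2) ^ k < ν (ball x (r₀ * (1 / 2) ^ (M + k)))}
      ≤ ENNReal.ofReal ((5 * r₀) ^ B) * (1 / 2) ^ M * ν univ := by
  refine varHausdorffContent_le_mul_measure_univ hU (sep_subset _ _)
    (fun x hx => (zero_lt_one.trans_le (hβ x hx)).ne') (R := r₀) ?_
  rintro x ⟨hx, k, hk⟩
  have hρ1 : (1 / 2 : ℝ) ^ (M + k) ≤ 1 := pow_le_one₀ (by norm_num) (by norm_num)
  refine ⟨r₀ * (1 / 2) ^ (M + k), by positivity, mul_le_of_le_one_right (by linarith) hρ1, ?_⟩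
  calc ENNReal.ofReal ((5 * (r₀ * (1 / 2) ^ (M + k))) ^ β x)
      ≤ ENNReal.ofReal ((5 * r₀) ^ B * (1 / 2) ^ (M + k)) := by
        rw [← mul_assoc]
        exact ENNReal.ofReal_le_ofReal
          (mul_rpow_le_rpow_mul (by linarith) (by positivity) hρ1 (hβ x hx) (hB x hx))
    _ = ENNReal.ofReal ((5 * r₀) ^ B) * (1 / 2) ^ M * (1 / 2) ^ k := by
        rw [ENNReal.ofReal_mul (by positivity), ofReal_half_pow, pow_add, ← mul_assoc]
    _ ≤ _ := mul_le_mul' le_rfl hk.le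

theorem tendsto_div_log_exp_one_add_one_div (c : ℝ) :
    Tendsto (fun r : ℝ => c / Real.log (Real.exp 1 + 1 / r)) (𝓝[>] 0) (𝓝 0) := by
  simp only [one_div]
  exact tendsto_const_nhds.div_atTop (Real.tendsto_log_atTop.comp
    (tendsto_atTop_add_const_left _ _ tendsto_inv_nhdsGT_zero))

theorem IsLogHolderOn.continuousOn {E : Type*} [MetricSpace E] {g : E → ℝ} {U : Set E}
    (h : IsLogHolderOn g U) : ContinuousOn g U := by
  obtain ⟨c, -, hg⟩ := h
  intro x hx
  rw [← continuousWithinAt_sdiff_self, ContinuousWithinAt, tendsto_iff_dist_tendsto_zero]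
  have hdist : Tendsto (fun y => dist y x) (𝓝[U \ {x}] x) (𝓝[>] 0) :=
    tendsto_nhdsWithin_iff.2 ⟨((continuous_id.dist continuous_const).tendsto' x 0
      (dist_self x)).mono_left inf_le_left,
      eventually_mem_nhdsWithin.mono fun y hy => dist_pos.2 hy.2⟩
  refine squeeze_zero' (Eventually.of_forall fun _ => dist_nonneg) ?_
    ((tendsto_div_log_exp_one_add_one_div c).comp hdist)
  filter_upwards [eventually_mem_nhdsWithin] with y hy
  exact hg y hy.1 x hx hy.2

theorem IsLogHolderOn.mul_const {E : Type*} [MetricSpace E] {g : E → ℝ} {U : Set E}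
    (h : IsLogHolderOn g U) {k : ℝ} (hk : 0 < k) : IsLogHolderOn (fun x => g x * k) U := by
  obtain ⟨c, hc, hg⟩ := h
  refine ⟨c * k, by positivity, fun x hx y hy hxy => ?_⟩
  rw [← sub_mul, abs_mul, abs_of_pos hk, mul_div_right_comm]
  exact mul_le_mul_of_nonneg_right (hg x hx y hy hxy) hk.le

theorem le_essSupOn_of_continuousOn {E : Type*} [MetricSpace E] [MeasureSpace E]
    [OpensMeasurableSpace E] [(volume : Measure E).IsOpenPosMeasure] {s : E → ℝ} {D : Set E}
    (hD : IsOpen D) (hs : ContinuousOn s D) {C : ℝ} (hC : ∀ᵐ x ∂(volume.restrict D), s x ≤ C)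
    {x : E} (hx : x ∈ D) : s x ≤ essSupOn s D := by
  have hae : ∀ᵐ y ∂(volume.restrict D), s y ≤ essSupOn s D :=
    ae_le_essSup ⟨C, eventually_map.2 hC⟩
  have hnull : volume (D ∩ s ⁻¹' Ioi (essSupOn s D)) = 0 := by
    refine measure_mono_null (fun y hy => ?_) (ae_iff.1 ((ae_restrict_iff' hD.measurableSet).1 hae))
    exact fun h => (h hy.1).not_gt hy.2
  have hempty := (hs.isOpen_inter_preimage hD isOpen_Ioi).eq_empty_of_measure_zero hnull
  exact not_lt.1 fun hlt => (hempty.le ⟨hx, hlt⟩ : x ∈ (∅ : Set E))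

theorem varModular_congr_exponent {E : Type*} [MeasureSpace E] {D : Set E} (hD : MeasurableSet D)
    {p p' : E → ℝ} (h : EqOn p p' D) (f : E → ℝ) : varModular D p f = varModular D p' f :=
  setLIntegral_congr_fun hD fun x hx => by rw [h hx]

theorem varModular_le_of_luxemburgNorm_le_one {E : Type*} [MeasureSpace E] {D : Set E}
    (hD : MeasurableSet D) {p f : E → ℝ} {P : ℝ} (hp : ∀ x ∈ D, 0 ≤ p x) (hP : ∀ x ∈ D, p x ≤ P)
    (h : luxemburgNorm D p f ≤ 1) : varModular D p f ≤ ENNReal.ofReal (2 ^ P) := by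
  have hlt : luxemburgNorm D p f < ENNReal.ofReal 2 := h.trans_lt (by simp)
  simp only [luxemburgNorm, iInf_lt_iff] at hlt
  obtain ⟨l, hl, hmod, hl2⟩ := hlt
  rw [ENNReal.ofReal_lt_ofReal_iff two_pos] at hl2
  have hpointwise : ∀ x ∈ D, |f x| ^ p x ≤ 2 ^ P * |f x / l| ^ p x := fun x hx => by
    have hpx := hp x hx
    calc |f x| ^ p x = (l * |f x / l|) ^ p x := by
          rw [abs_div, abs_of_pos hl, mul_div_cancel₀ _ hl.ne']
      _ ≤ (2 * |f x / l|) ^ p x := by gcongr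
      _ = 2 ^ p x * |f x / l| ^ p x := Real.mul_rpow zero_le_two (abs_nonneg _)
      _ ≤ 2 ^ P * |f x / l| ^ p x := by
          gcongr
          · exact one_le_two
          · exact hP x hx
  calc varModular D p f
      ≤ ∫⁻ x in D, ENNReal.ofReal (2 ^ P) * ENNReal.ofReal (|f x / l| ^ p x) := by
        refine setLIntegral_mono' hD fun x hx => ?_
        rw [← ENNReal.ofReal_mul (by positivity)]
        exact ENNReal.ofReal_le_ofReal (hpointwise x hx)
    _ = ENNReal.ofReal (2 ^ P) * varModular D p (fun x => f x / l) :=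
        lintegral_const_mul' _ _ ENNReal.ofReal_ne_top
    _ ≤ ENNReal.ofReal (2 ^ P) := mul_le_of_le_one_right' hmod

theorem varModular_div_sub_le_of_luxemburgNorm_le_one {E : Type*} [MeasureSpace E] {D : Set E}
    (hD : MeasurableSet D) {α β f : E → ℝ} {B N : ℝ} (hN : 0 ≤ N) (hB : ∀ x ∈ D, β x ≤ B)
    (hBN : B < N) (hα : ∀ x ∈ D, α x = N - β x) (h : luxemburgNorm D (fun x => N / α x) f ≤ 1) :
    varModular D (fun x => N / (N - β x)) f ≤ ENNReal.ofReal (2 ^ (N / (N - B))) := by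
  have hα_ge : ∀ x ∈ D, N - B ≤ α x := fun x hx => (sub_le_sub_left (hB x hx) N).trans_eq
    (hα x hx).symm
  have hNB : 0 < N - B := sub_pos.2 hBN
  have hexponent : EqOn (fun x => N / (N - β x)) (fun x => N / α x) D := fun x hx => by
    simp only [hα x hx]
  rw [varModular_congr_exponent hD hexponent]
  exact varModular_le_of_luxemburgNorm_le_one hD
    (fun x hx => div_nonneg hN (hNB.le.trans (hα_ge x hx)))
    (fun x hx => div_le_div_of_nonneg_left hN hNB (hα_ge x hx)) h

theorem choquetIntegral_le_add_lintegral_Ioi {E : Type*} {H : Set E → ℝ≥0∞} {D : Set E}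
    {f : E → ℝ} {T : ℝ} {C : ℝ≥0∞} {φ : ℝ → ℝ≥0∞} (hT : 0 ≤ T)
    (hsmall : ∀ t ∈ Ioc 0 T, H {x ∈ D | t < |f x|} ≤ C)
    (hlarge : ∀ t ∈ Ioi T, H {x ∈ D | t < |f x|} ≤ φ t) :
    choquetIntegral H D f ≤ C * ENNReal.ofReal T + ∫⁻ t in Ioi T, φ t := by
  rw [choquetIntegral, ← Ioc_union_Ioi_eq_Ioi hT]
  refine (lintegral_union_le _ _ _).trans (add_le_add ?_ ?_)
  · refine (setLIntegral_mono' measurableSet_Ioc hsmall).trans_eq ?_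
    rw [setLIntegral_const, Real.volume_Ioc, sub_zero]
  · exact setLIntegral_mono' measurableSet_Ioi hlarge

theorem lintegral_Ioi_rpow_ne_top {a c : ℝ} (ha : a < -1) (hc : 0 < c) :
    ∫⁻ t in Ioi c, ENNReal.ofReal (t ^ a) ≠ ⊤ :=
  (integrableOn_Ioi_rpow_of_lt ha hc).lintegral_lt_top.ne

theorem mul_rpow_inv_lt_of_lt_exp {a C q t v y : ℝ} (ha : 0 < a) (hC : 0 ≤ C) (hq : 0 < q)
    (ht : 0 < t) (hv : 0 ≤ v) (hy : 0 ≤ y) (hyt : a * (C ^ q * y) ≤ Real.log t)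
    (htv : t < Real.exp (a * v ^ q)) : C * y ^ q⁻¹ < v := by
  refine (Real.rpow_lt_rpow_iff (by positivity) hv hq).1 ?_
  rw [Real.mul_rpow hC (by positivity), Real.rpow_inv_rpow hy hq.ne']
  exact lt_of_mul_lt_mul_left (hyt.trans_lt ((Real.log_lt_iff_lt_exp ht).2 htv)) ha.le

theorem half_pow_floor_two_mul_logb_le {t : ℝ} (ht : 0 < t) :
    (1 / 2 : ℝ) ^ ⌊2 * Real.logb 2 t⌋₊ ≤ 2 * t ^ (-2 : ℝ) := by
  have hpow : (2 : ℝ) ^ Real.logb 2 t = t := Real.rpow_logb two_pos (by norm_num) ht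
  calc (1 / 2 : ℝ) ^ ⌊2 * Real.logb 2 t⌋₊ = 2 ^ (-(⌊2 * Real.logb 2 t⌋₊ : ℝ)) := by
        rw [Real.rpow_neg zero_le_two, Real.rpow_natCast, one_div, inv_pow]
    _ ≤ 2 ^ (1 + Real.logb 2 t * (-2)) :=
        Real.rpow_le_rpow_of_exponent_le one_le_two
          (by linarith [Nat.sub_one_lt_floor (2 * Real.logb 2 t)])
    _ = 2 * t ^ (-2 : ℝ) := by
        rw [Real.rpow_add two_pos, Real.rpow_one, Real.rpow_mul zero_le_two, hpow]

/-- The constant `log 2 / (2 C₁ ^ q)` is half of the critical one, which turns a decay like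
`t ^ (-1)` into one like `t ^ (-2)`. -/
theorem levelSet_exp_le_of_levelSet_le {E : Type*} {H : Set E → ℝ≥0∞} (hH : Monotone H)
    {D : Set E} {v : E → ℝ} {C₁ q : ℝ} {C₂ : ℝ≥0∞} (hC₁ : 0 < C₁) (hq : 0 < q)
    (hv : ∀ M : ℕ, 1 ≤ M → H {x ∈ D | C₁ * (M : ℝ) ^ q⁻¹ < |v x|} ≤ C₂ * (1 / 2) ^ M)
    {t : ℝ} (ht : 2 ≤ t) :
    H {x ∈ D | t < Real.exp (Real.log 2 / (2 * C₁ ^ q) * |v x| ^ q)}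
      ≤ C₂ * ENNReal.ofReal (2 * t ^ (-2 : ℝ)) := by
  have ht0 : 0 < t := by linarith
  have hlogb : 1 ≤ Real.logb 2 t := by
    rwa [Real.le_logb_iff_rpow_le one_lt_two ht0, Real.rpow_one]
  set M := ⌊2 * Real.logb 2 t⌋₊
  have hM : (M : ℝ) ≤ 2 * Real.logb 2 t := Nat.floor_le (by linarith)
  have hMlog : Real.log 2 / (2 * C₁ ^ q) * (C₁ ^ q * M) ≤ Real.log t := by
    calc Real.log 2 / (2 * C₁ ^ q) * (C₁ ^ q * M) = Real.log 2 / 2 * M := by field_simp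
      _ ≤ Real.log 2 / 2 * (2 * Real.logb 2 t) := by gcongr
      _ = Real.log t := by rw [Real.logb]; field_simp
  have hlevel : {x ∈ D | t < Real.exp (Real.log 2 / (2 * C₁ ^ q) * |v x| ^ q)}
      ⊆ {x ∈ D | C₁ * (M : ℝ) ^ q⁻¹ < |v x|} := fun x hx =>
    ⟨hx.1, mul_rpow_inv_lt_of_lt_exp (by positivity) hC₁.le hq ht0 (abs_nonneg _)
      M.cast_nonneg hMlog hx.2⟩
  refine (hH hlevel).trans ((hv M (Nat.le_floor (by push_cast; linarith))).trans ?_)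
  refine mul_le_mul' le_rfl ?_
  rw [← ofReal_half_pow]
  exact ENNReal.ofReal_le_ofReal (half_pow_floor_two_mul_logb_le ht0)

theorem exists_choquetIntegral_exp_le {C₁ q : ℝ} {C₂ : ℝ≥0∞} (hC₁ : 0 < C₁) (hq : 0 < q)
    (hC₂ : C₂ ≠ ⊤) :
    ∃ a b : ℝ, 0 < a ∧ 0 < b ∧ ∀ {E : Type*} {H : Set E → ℝ≥0∞} {D : Set E} {v : E → ℝ},
      Monotone H → H D ≤ C₂ →
      (∀ M : ℕ, 1 ≤ M → H {x ∈ D | C₁ * (M : ℝ) ^ q⁻¹ < |v x|} ≤ C₂ * (1 / 2) ^ M) →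
      choquetIntegral H D (fun x => Real.exp (a * |v x| ^ q)) ≤ ENNReal.ofReal b := by
  set I : ℝ≥0∞ := ∫⁻ t in Ioi (2 : ℝ), ENNReal.ofReal (t ^ (-2 : ℝ))
  have hI : I ≠ ⊤ := lintegral_Ioi_rpow_ne_top (by norm_num) two_pos
  set Z : ℝ≥0∞ := C₂ * ENNReal.ofReal 2 + C₂ * (ENNReal.ofReal 2 * I)
  have hZ : Z ≠ ⊤ := by finiteness
  refine ⟨Real.log 2 / (2 * C₁ ^ q), Z.toReal + 1, by positivity, by positivity,
    fun {_ H D v} hH hHD hv => ?_⟩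
  calc choquetIntegral H D (fun x => Real.exp (Real.log 2 / (2 * C₁ ^ q) * |v x| ^ q))
      ≤ C₂ * ENNReal.ofReal 2 +
          ∫⁻ t in Ioi (2 : ℝ), C₂ * ENNReal.ofReal (2 * t ^ (-2 : ℝ)) := by
        refine choquetIntegral_le_add_lintegral_Ioi zero_le_two
          (fun t _ => (hH (sep_subset _ _)).trans hHD) fun t ht => ?_
        simp only [Real.abs_exp]
        exact levelSet_exp_le_of_levelSet_le hH hC₁ hq hv (mem_Ioi.1 ht).le
    _ = Z := by
        simp only [ENNReal.ofReal_mul zero_le_two]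
        rw [lintegral_const_mul' _ _ hC₂, lintegral_const_mul' _ _ ENNReal.ofReal_ne_top]
    _ ≤ ENNReal.ofReal (Z.toReal + 1) :=
        ENNReal.le_ofReal_iff_toReal_le hZ (by positivity) |>.2 (by linarith)

theorem volume_ball_eq_mul_rpow {n : ℕ} (x : EuclideanSpace ℝ (Fin n)) {r : ℝ}
    (hr : 0 < r) :
    volume (ball x r)
      = volume (ball (0 : EuclideanSpace ℝ (Fin n)) 1) * ENNReal.ofReal (r ^ (n : ℝ)) := by
  rw [Measure.addHaar_ball_of_pos volume x hr, finrank_euclideanSpace_fin, Real.rpow_natCast,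
    mul_comm]

section JohnDomain

variable {n : ℕ} {D : Set (EuclideanSpace ℝ (Fin n))} {s : EuclideanSpace ℝ (Fin n) → ℝ}
  {x₀ : EuclideanSpace ℝ (Fin n)} {S : ℝ} {W : ℝ≥0∞}

theorem IsVarJohnDomain.one_le_mul (hn : 2 ≤ n) (hD : IsVarJohnDomain D s x₀)
    {x : EuclideanSpace ℝ (Fin n)} (hx : x ∈ D) : 1 ≤ s x * ((n : ℝ) - 1) := by
  obtain ⟨a, b, hab⟩ := hD
  have hn' : (2 : ℝ) ≤ n := by exact_mod_cast hn
  nlinarith [hab.one_le x hx]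

theorem IsVarJohnDomain.exists_abs_preciseRep_sub_le (hn : 2 ≤ n) (hD : IsVarJohnDomain D s x₀)
    (hs : IsLogHolderOn s D) (hsS : ∀ x ∈ D, s x ≤ S) (hSn : S * ((n : ℝ) - 1) < n)
    (hW : W ≠ ⊤) :
    ∃ r₀ : ℝ, 1 ≤ r₀ ∧ (∀ x ∈ D, D ⊆ ball x r₀) ∧ ∃ C : ℝ, 0 < C ∧ ∀ u g,
      HasWeakGradientOn D u g →
      varModular D (fun y => (n : ℝ) / (n - s y * (n - 1))) (‖g ·‖) ≤ W →
      ∀ x ∈ D, ∀ M : ℕ, 1 ≤ M →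
      (∀ k, modularMeasure D (fun y => (n : ℝ) / (n - s y * (n - 1))) (‖g ·‖)
        (ball x (r₀ * (1 / 2) ^ (M + k))) ≤ (1 / 2) ^ k) →
      |preciseRep u x - ⨍ y in ball x₀ (infDist x₀ (frontier D)), u y|
        ≤ C * (M : ℝ) ^ (S * ((n : ℝ) - 1) / n) := by
  have : NeZero n := ⟨by omega⟩
  have hn1 : 0 < (n : ℝ) - 1 := sub_pos.2 (by exact_mod_cast hn)
  obtain ⟨r₀, hr₀, hDr₀, Cp, hCp, hrep⟩ := hD.exists_edist_preciseRep_le hsS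
  have hDmeas : MeasurableSet D := by
    obtain ⟨a, b, hab⟩ := hD
    exact hab.isOpen.measurableSet
  obtain ⟨Cg, hCg, hgrowth⟩ := (hs.mul_const hn1).exists_dyadicPotential_le hDmeas
    (fun y hy => hD.one_le_mul hn hy) (fun y hy => mul_le_mul_of_nonneg_right (hsS y hy) hn1.le)
    hSn measure_ball_lt_top.ne (fun x _ hr => (volume_ball_eq_mul_rpow x hr).le)
    (zero_lt_one.trans_le hr₀) hW
  refine ⟨r₀, hr₀, hDr₀, (Cp * Cg).toReal + 1, by positivity,
    fun u g hu hg x hx M hM hconc => ?_⟩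
  have hedist := calc
    edist (preciseRep u x) (⨍ y in ball x₀ (infDist x₀ (frontier D)), u y)
      ≤ Cp * (Cg * ENNReal.ofReal ((M : ℝ) ^ (S * ((n : ℝ) - 1) / n))) := by
        refine (hrep u g hu x hx).trans (mul_le_mul' le_rfl ?_)
        simpa only [enorm_norm] using hgrowth (‖g ·‖) x M hg hx hM hconc
    _ = ENNReal.ofReal ((Cp * Cg).toReal * (M : ℝ) ^ (S * ((n : ℝ) - 1) / n)) := by
        rw [ENNReal.ofReal_mul ENNReal.toReal_nonneg, ENNReal.ofReal_toReal (by finiteness),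
          mul_assoc]
  rw [edist_dist, ENNReal.ofReal_le_ofReal_iff (by positivity), Real.dist_eq] at hedist
  exact hedist.trans (by gcongr; linarith)

theorem IsVarJohnDomain.exists_varHausdorffContent_levelSet_le (hn : 2 ≤ n)
    (hD : IsVarJohnDomain D s x₀) (hs : IsLogHolderOn s D) (hsS : ∀ x ∈ D, s x ≤ S)
    (hSn : S * ((n : ℝ) - 1) < n) (hW : W ≠ ⊤) :
    ∃ (C₁ : ℝ) (C₂ : ℝ≥0∞), 0 < C₁ ∧ C₂ ≠ ⊤ ∧
      varHausdorffContent D (fun x => s x * ((n : ℝ) - 1)) D ≤ C₂ ∧ ∀ u g,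
      HasWeakGradientOn D u g →
      varModular D (fun y => (n : ℝ) / (n - s y * (n - 1))) (‖g ·‖) ≤ W →
      ∀ M : ℕ, 1 ≤ M →
      varHausdorffContent D (fun x => s x * ((n : ℝ) - 1))
        {x ∈ D | C₁ * (M : ℝ) ^ (S * ((n : ℝ) - 1) / n) <
          |preciseRep u x - ⨍ y in ball x₀ (infDist x₀ (frontier D)), u y|}
        ≤ C₂ * (1 / 2) ^ M := by
  obtain ⟨r₀, hr₀, hDr₀, C, hC, hrep⟩ := hD.exists_abs_preciseRep_sub_le hn hs hsS hSn hW
  have hx₀ : x₀ ∈ D := by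
    obtain ⟨a, b, hab⟩ := hD
    exact hab.center_mem
  have hβ : ∀ x ∈ D, 1 ≤ s x * ((n : ℝ) - 1) := fun x hx => hD.one_le_mul hn hx
  have hβS : ∀ x ∈ D, s x * ((n : ℝ) - 1) ≤ S * ((n : ℝ) - 1) := fun x hx =>
    mul_le_mul_of_nonneg_right (hsS x hx) (sub_nonneg.2 (by exact_mod_cast (by omega : 1 ≤ n)))
  set A := ENNReal.ofReal (r₀ ^ (s x₀ * ((n : ℝ) - 1)))
  set B := ENNReal.ofReal ((5 * r₀) ^ (S * ((n : ℝ) - 1)))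
  refine ⟨C, A + B * W, hC, by finiteness, ?_, fun u g hu hg M hM => ?_⟩
  · exact (varHausdorffContent_le_of_subset_ball hx₀ (zero_lt_one.trans_le (hβ x₀ hx₀)).ne'
      (zero_le_one.trans hr₀) (hDr₀ x₀ hx₀)).trans le_self_add
  set ν := modularMeasure D (fun y => (n : ℝ) / (n - s y * (n - 1))) (‖g ·‖)
  calc _ ≤ varHausdorffContent D (fun x => s x * ((n : ℝ) - 1))
          {x ∈ D | ∃ k, (1 / 2) ^ k < ν (ball x (r₀ * (1 / 2) ^ (M + k)))} := by
        refine monotone_varHausdorffContent _ _ fun x hx => ⟨hx.1, ?_⟩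
        by_contra! hconc
        exact hx.2.not_ge (hrep u g hu hg x hx.1 M hM hconc)
    _ ≤ B * (1 / 2) ^ M * ν univ :=
        varHausdorffContent_concentration_le ⟨x₀, hx₀⟩ hβ hβS hr₀ ν M
    _ ≤ B * (1 / 2) ^ M * W := by
        rw [modularMeasure_univ]
        gcongr
    _ = B * W * (1 / 2) ^ M := by ring
    _ ≤ (A + B * W) * (1 / 2) ^ M := by gcongr; exact le_add_self

end JohnDomain

end

theorem mainTheorem2 (n : ℕ) (hn : 2 ≤ n) (D : Set (EuclideanSpace ℝ (Fin n)))
    (s : EuclideanSpace ℝ (Fin n) → ℝ) (x₀ : EuclideanSpace ℝ (Fin n))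
    (hD : IsVarJohnDomain D s x₀) (hs : IsLogHolderExponent s D)
    (hs_inf : 1 ≤ essInfOn s D) (hs_sup : essSupOn s D < (n : ℝ) / ((n : ℝ) - 1))
    (α : EuclideanSpace ℝ (Fin n) → ℝ) (hα : ∀ x ∈ D, α x = (n : ℝ) - s x * ((n : ℝ) - 1)) :
    ∃ a b : ℝ, 0 < a ∧ 0 < b ∧
      ∀ (u : EuclideanSpace ℝ (Fin n) → ℝ)
        (gradu : EuclideanSpace ℝ (Fin n) → EuclideanSpace ℝ (Fin n)),
        MemVarSobolev D (fun x => (n : ℝ) / α x) u gradu →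
        luxemburgNorm D (fun x => (n : ℝ) / α x) (fun x => ‖gradu x‖) ≤ 1 →
        choquetIntegral (varHausdorffContent D (fun x => s x * ((n : ℝ) - 1))) D
          (fun x => Real.exp (a *
            |preciseRep u x - ⨍ y in Metric.ball x₀ (Metric.infDist x₀ (frontier D)), u y|
              ^ ((n : ℝ) / (essSupOn s D * ((n : ℝ) - 1)))))
          ≤ ENNReal.ofReal b := by
  obtain ⟨_, _, hJohn⟩ := id hD
  obtain ⟨_, hbdd⟩ := hs.essBounded
  have hn1 : 0 < (n : ℝ) - 1 := sub_pos.2 (by exact_mod_cast hn)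
  have hsS : ∀ x ∈ D, s x ≤ essSupOn s D := fun _ =>
    le_essSupOn_of_continuousOn hJohn.isOpen hs.logHolder.continuousOn hbdd
  have hβS : ∀ x ∈ D, s x * ((n : ℝ) - 1) ≤ essSupOn s D * ((n : ℝ) - 1) := fun x hx =>
    mul_le_mul_of_nonneg_right (hsS x hx) hn1.le
  have hSn : essSupOn s D * ((n : ℝ) - 1) < n := (lt_div_iff₀ hn1).1 hs_sup
  have hS : 0 < essSupOn s D * ((n : ℝ) - 1) := zero_lt_one.trans_le
    ((hD.one_le_mul hn hJohn.center_mem).trans (hβS x₀ hJohn.center_mem))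
  obtain ⟨C₁, C₂, hC₁, hC₂, hcontent, hlevel⟩ :=
    hD.exists_varHausdorffContent_levelSet_le hn hs.logHolder hsS hSn ENNReal.ofReal_ne_top
  obtain ⟨a, b, ha, hb, hexp⟩ := exists_choquetIntegral_exp_le hC₁ (div_pos (hS.trans hSn) hS) hC₂
  refine ⟨a, b, ha, hb, fun u gradu hu hnorm => ?_⟩
  have hmod := varModular_div_sub_le_of_luxemburgNorm_le_one hJohn.isOpen.measurableSet
    n.cast_nonneg hβS hSn hα hnorm
  refine hexp (monotone_varHausdorffContent D _) hcontent ?_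
  simpa only [inv_div] using hlevel u gradu hu.hasWeakGradient hmod
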